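/- Let $\Gamma_n$ ($n\ge 2$) be the set of all $(\alpha,\beta)$ with $\alpha,\beta>0$ such that $$\tfrac n2\tfrac{\pi}{\sqrt\alpha}+\tfrac n2\tfrac{\pi}{\sqrt\beta}=\pi \ \text{ if } n \text{ is even},\qquad \tfrac{n+1}2\tfrac{\pi}{\sqrt\alpha}+\tfrac{n-1}2\tfrac{\pi}{\sqrt\beta}=\pi\ \text{ if } n \text{ is odd}.$$ For $(\alpha,\beta)\in\Gamma_n$ the normalized Fučík eigenfunction $f^n_{\alpha,\beta}$ is the $C^2$-solution on $[0,\pi]$ of $$-u''=\alpha u^+-\beta u^-\ \text{ in }(0,\pi),\qquad u(0)=u(\pi)=0,$$ where $u^+=\max(u,0)$ and $u^-=\max(-u,0)$, with $u'(0)>0$ and $\sup_{[0,\pi]}|u|=1$; moreover $f^1_{1,1}(x)=\sin x$. A Fučík system is a sequence $F_{\alpha,\beta}=\{f^n_{\alpha(n),\beta(n)}\}_{n\ge1}$ with $\alpha(1)=\beta(1)=1$ and $(\alpha(n),\beta(n))\in\Gamma_n$ for every $n\ge2$. For $n\ge2$ set $$C_n(x,y)=\begin{cases}\dfrac{4(3+\pi^2)\pi}{9}\left(\dfrac{\max(\sqrt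 x,\sqrt y)}{n}-1\right)^2 & n\text{ even},\\[2mm] 4\pi\,\dfrac{n^2(n^2+1)}{(n-1)^4}\left(\dfrac{\sqrt x}{n}-1\right)^2 & n\text{ odd},\ x\ge y,\\[2mm] 5\pi\,\dfrac{n^2(n^2+1)}{(n+1)^4}\left(\dfrac{\sqrt y}{n}-1\right)^2 & n\text{ odd},\ y>x.\end{cases}$$ **Theorem.** Let $F_{\alpha,\beta}$ be a Fučík system. If $\sum_{n=2}^\infty C_n(\alpha(n),\beta(n))<\frac{\pi}{2}$, then $F_{\alpha,\beta}$ is a Riesz basis of $L^2(0,\pi)$ (with real or complex scalars). That is, the linear span of $F_{\alpha,\beta}$ is dense in $L^2(0,\pi)$, and there are constants $c,C>0$ such that $$c\sum_{n=1}^N|a_n|^2\le\Big\|\sum_{n=1}^N a_n f^n_{\alpha(n),\beta(n)}\Big\|^2_{L^2(0,\pi)}\le C\sum_{n=1}^N|a_n|^2$$ for all $N\in\mathbb N$ and all scalars $a_1,\dots,a_N$. -/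

import Mathlib

open Real Set MeasureTheory

noncomputable section

/-- `u` is a classical solution, of class `C²` on `[0, π]`, of the Dirichlet problem
`-u'' = α u⁺ - β u⁻` in `(0, π)`, `u 0 = u π = 0`. -/
structure IsFucikSolution (α β : ℝ) (u : ℝ → ℝ) : Prop where
  contDiffOn : ContDiffOn ℝ 2 u (Icc 0 π)
  equation : ∀ x ∈ Ioo 0 π, -deriv (deriv u) x = α * max (u x) 0 - β * max (-u x) 0
  left : u 0 = 0
  right : u π = 0

/-- A normalized Fučík eigenfunction: a classical solution with positive slope at `0` and with
supremum norm `1` on `[0, π]`. -/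
structure IsNormalizedFucikEigenfunction (α β : ℝ) (u : ℝ → ℝ) : Prop where
  solution : IsFucikSolution α β u
  slope_pos : 0 < derivWithin u (Icc 0 π) 0
  norm_one : IsLUB ((fun x => |u x|) '' Icc 0 π) 1

/-- The Fučík curve `Γ n`, whose eigenfunctions start with a positive bump: `n / 2` positive and
`n / 2` negative bumps for even `n`, `(n + 1) / 2` positive and `(n - 1) / 2` negative bumps for
odd `n`. -/
def fucikCurve (n : ℕ) : Set (ℝ × ℝ) :=
  {p | 0 < p.1 ∧ 0 < p.2 ∧
    if Even n then (n : ℝ) / 2 * (π / √p.1) + (n : ℝ) / 2 * (π / √p.2) = π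
    else ((n : ℝ) + 1) / 2 * (π / √p.1) + ((n : ℝ) - 1) / 2 * (π / √p.2) = π}

/-- The functions `f n`, `n ≥ 1`, form the Fučík system of the mappings `α` and `β`.
The values of `α`, `β`, `f` at the index `0` play no role. -/
structure IsFucikSystem (α β : ℕ → ℝ) (f : ℕ → ℝ → ℝ) : Prop where
  alpha_one : α 1 = 1
  beta_one : β 1 = 1
  mem_curve : ∀ n, 2 ≤ n → (α n, β n) ∈ fucikCurve n
  first : EqOn (f 1) sin (Icc 0 π)
  eigenfunction : ∀ n, 2 ≤ n → IsNormalizedFucikEigenfunction (α n) (β n) (f n)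

/-- The weights `C_n(x, y)`. -/
def fucikWeight (n : ℕ) (x y : ℝ) : ℝ :=
  if Even n then 4 * (3 + π ^ 2) * π / 9 * (max (√x) (√y) / n - 1) ^ 2
  else if y ≤ x then
    4 * π * ((n : ℝ) ^ 2 * ((n : ℝ) ^ 2 + 1) / ((n : ℝ) - 1) ^ 4) * (√x / n - 1) ^ 2
  else
    5 * π * ((n : ℝ) ^ 2 * ((n : ℝ) ^ 2 + 1) / ((n : ℝ) + 1) ^ 4) * (√y / n - 1) ^ 2

/-- A sequence in a Hilbert space is a Riesz basis if it is complete (its linear span is dense)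
and the squared norm of every finite linear combination is comparable, with uniform positive
constants, to the sum of the squared moduli of the coefficients. -/
def IsRieszBasis (𝕜 : Type*) {H : Type*} [RCLike 𝕜] [NormedAddCommGroup H]
    [InnerProductSpace 𝕜 H] (ψ : ℕ → H) : Prop :=
  (Submodule.span 𝕜 (range ψ)).topologicalClosure = ⊤ ∧
    ∃ c C : ℝ, 0 < c ∧ 0 < C ∧ ∀ (N : ℕ) (a : ℕ → 𝕜),
      c * ∑ k ∈ Finset.range N, ‖a k‖ ^ 2 ≤ ‖∑ k ∈ Finset.range N, a k • ψ k‖ ^ 2 ∧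
      ‖∑ k ∈ Finset.range N, a k • ψ k‖ ^ 2 ≤ C * ∑ k ∈ Finset.range N, ‖a k‖ ^ 2

end

/-! ### Stability of orthogonal bases under quadratically small perturbations. -/

section abstract
variable {𝕜 H : Type*} [RCLike 𝕜] [NormedAddCommGroup H] [InnerProductSpace 𝕜 H]

/-! The Fučík system is treated as a perturbation of the complete orthogonal system sin(nx), whose
members have squared norm π/2. A sequence whose squared distances to a complete orthogonal sequence
of squared norm c sum to less than c is a Riesz basis (`isRieszBasis_of_tsum_norm_sub_sq_lt`):
Cauchy–Schwarz controls the difference of the linear combinations, and Parseval excludes a nonzero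
vector orthogonal to the perturbed sequence. Since the first function is sin x, it remains to bound
the squared distance from f n to sin(nx) by C_n for n ≥ 2 (`integral_sub_sin_sq_le_fucikWeight`).

Uniqueness for the ODE forces f n to be a chain of alternating sine arches of frequencies √α and √β,
with the same absolute slope p at every zero (`IsFucikSolution.eq_on_arch`); the normalization gives
p = min(√α, √β). Expanding the square, ∫ f² is an elementary sum over arches, and the cross term ∫ f
sin(nx) collapses to p T (1/(α − n²) − 1/(β − n²)), where T is built from sines and depends on the
parity of n (`sum_sin_archZero_even`, `sum_sin_archZero_odd`).

Bounding T below through sin x ≥ x − x³/6 leaves a rational inequality in δ = 1 − n/ω, with ω the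
larger frequency (`distance_sq_le_of_arches`). The constants it yields are at most those in C_n. -/

theorem norm_sum_smul_sq_of_orthogonal {φ : ℕ → H} {c : ℝ}
    (horth : ∀ i j, inner 𝕜 (φ i) (φ j) = if i = j then (c : 𝕜) else 0) (s : Finset ℕ)
    (a : ℕ → 𝕜) : ‖∑ k ∈ s, a k • φ k‖ ^ 2 = c * ∑ k ∈ s, ‖a k‖ ^ 2 := by
  have h : ((‖∑ k ∈ s, a k • φ k‖ ^ 2 : ℝ) : 𝕜) = ((c * ∑ k ∈ s, ‖a k‖ ^ 2 : ℝ) : 𝕜) := by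
    push_cast
    rw [← inner_self_eq_norm_sq_to_K (𝕜 := 𝕜), sum_inner, Finset.mul_sum]
    refine Finset.sum_congr rfl fun i hi => ?_
    rw [inner_sum, Finset.sum_eq_single i]
    · rw [inner_smul_left, inner_smul_right, horth, if_pos rfl, ← mul_assoc, RCLike.conj_mul]
      ring
    · intro j _ hj
      rw [inner_smul_left, inner_smul_right, horth, if_neg hj.symm]
      simp
    · exact fun h => absurd hi h
  exact_mod_cast h

/-- Triangle inequality, then Cauchy–Schwarz in the index; no orthogonality of the `δ k` is needed.
-/
theorem norm_sum_smul_le_of_summable_sq {δ : ℕ → H} (hs : Summable fun k => ‖δ k‖ ^ 2)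
    (s : Finset ℕ) (a : ℕ → 𝕜) :
    ‖∑ k ∈ s, a k • δ k‖ ≤ √(∑ k ∈ s, ‖a k‖ ^ 2) * √(∑' k, ‖δ k‖ ^ 2) := by
  calc ‖∑ k ∈ s, a k • δ k‖ ≤ ∑ k ∈ s, ‖a k‖ * ‖δ k‖ := by
        refine (norm_sum_le _ _).trans (Finset.sum_le_sum fun k _ => (norm_smul _ _).le)
    _ ≤ √(∑ k ∈ s, ‖a k‖ ^ 2) * √(∑ k ∈ s, ‖δ k‖ ^ 2) := Real.sum_mul_le_sqrt_mul_sqrt _ _ _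
    _ ≤ _ := by
        gcongr
        exact hs.sum_le_tsum s fun _ _ => sq_nonneg _

/-- Parseval's identity for the Hilbert basis `φ k / √c`. -/
theorem hasSum_norm_inner_sq_of_orthogonal_total [CompleteSpace H] {φ : ℕ → H} {c : ℝ} (hc : 0 < c)
    (horth : ∀ i j, inner 𝕜 (φ i) (φ j) = if i = j then (c : 𝕜) else 0)
    (htot : ∀ g : H, (∀ k, inner 𝕜 (φ k) g = 0) → g = 0) (g : H) :
    HasSum (fun k => ‖inner 𝕜 (φ k) g‖ ^ 2) (c * ‖g‖ ^ 2) := by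
  have hr : (√c)⁻¹ ≠ 0 := inv_ne_zero (Real.sqrt_pos.2 hc).ne'
  have hrk : (((√c)⁻¹ : ℝ) : 𝕜) ≠ 0 := by exact_mod_cast hr
  set e : ℕ → H := fun k => (((√c)⁻¹ : ℝ) : 𝕜) • φ k with he
  have hon : Orthonormal 𝕜 e := by
    rw [orthonormal_iff_ite]
    intro i j
    simp only [he, inner_smul_left, inner_smul_right, horth, RCLike.conj_ofReal]
    split_ifs
    · have : (√c)⁻¹ * ((√c)⁻¹ * c) = 1 := by
        rw [← mul_assoc, ← mul_inv, Real.mul_self_sqrt hc.le, inv_mul_cancel₀ hc.ne']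
      exact_mod_cast this
    · simp
  have hbot : (Submodule.span 𝕜 (range e))ᗮ = ⊥ := by
    rw [Submodule.eq_bot_iff]
    intro x hx
    refine htot x fun k => ?_
    have h := (Submodule.mem_orthogonal _ _).1 hx (e k) (Submodule.subset_span ⟨k, rfl⟩)
    simp only [he, inner_smul_left, RCLike.conj_ofReal] at h
    exact (mul_eq_zero.1 h).resolve_left hrk
  let b := HilbertBasis.mkOfOrthogonalEqBot hon hbot
  have hb : ∀ k, b k = e k := fun k => by simp [b]
  have h := (b.hasSum_inner_mul_inner g g).mapL (RCLike.reCLM (K := 𝕜))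
  have h2 := h.mul_left c
  have e1 : (fun k => c * RCLike.reCLM (inner 𝕜 g (b k) * inner 𝕜 (b k) g))
      = fun k => ‖inner 𝕜 (φ k) g‖ ^ 2 := by
    funext k
    simp only [hb, he, RCLike.reCLM_apply, inner_smul_left, inner_smul_right, RCLike.conj_ofReal]
    rw [← inner_conj_symm g (φ k)]
    have : (((√c)⁻¹ : ℝ) : 𝕜) * (starRingEnd 𝕜) (inner 𝕜 (φ k) g) *
        ((((√c)⁻¹ : ℝ) : 𝕜) * inner 𝕜 (φ k) g) = ((c⁻¹ * ‖inner 𝕜 (φ k) g‖ ^ 2 : ℝ) : 𝕜) := by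
      rw [mul_mul_mul_comm, RCLike.conj_mul]
      have h3 : (√c)⁻¹ * (√c)⁻¹ = c⁻¹ := by rw [← mul_inv, Real.mul_self_sqrt hc.le]
      rw [← RCLike.ofReal_mul, h3]
      push_cast; rfl
    rw [this, RCLike.ofReal_re, ← mul_assoc, mul_inv_cancel₀ hc.ne', one_mul]
  have e2 : RCLike.reCLM (inner 𝕜 g g) = ‖g‖ ^ 2 := by
    rw [RCLike.reCLM_apply, inner_self_eq_norm_sq]
  rw [e2, e1] at h2
  exact h2

/-- A Paley–Wiener type stability criterion: a sequence quadratically close to a complete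
orthogonal sequence of constant norm `√c` is a Riesz basis. -/
theorem isRieszBasis_of_tsum_norm_sub_sq_lt [CompleteSpace H] {φ ψ : ℕ → H} {c : ℝ}
    (horth : ∀ i j, inner 𝕜 (φ i) (φ j) = if i = j then (c : 𝕜) else 0)
    (htot : ∀ g : H, (∀ k, inner 𝕜 (φ k) g = 0) → g = 0)
    (hs : Summable fun k => ‖ψ k - φ k‖ ^ 2) (hlt : ∑' k, ‖ψ k - φ k‖ ^ 2 < c) :
    IsRieszBasis 𝕜 ψ := by
  have hD : 0 ≤ ∑' k, ‖ψ k - φ k‖ ^ 2 := tsum_nonneg fun _ => sq_nonneg _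
  set D := ∑' k, ‖ψ k - φ k‖ ^ 2 with hDdef
  have hc : 0 < c := hD.trans_lt hlt
  have hsq : √D < √c := Real.sqrt_lt_sqrt hD hlt
  refine ⟨?_, (√c - √D) ^ 2, (√c + √D) ^ 2, pow_pos (sub_pos.2 hsq) 2,
    pow_pos (add_pos_of_pos_of_nonneg (Real.sqrt_pos.2 hc) (Real.sqrt_nonneg _)) 2, ?_⟩
  · rw [Submodule.topologicalClosure_eq_top_iff, Submodule.eq_bot_iff]
    -- For g orthogonal to every `ψ k`, the coefficients against `φ k` are those against `ψ k - φ k`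
    -- up to sign, so Parseval gives c‖g‖² ≤ D‖g‖² with D < c.
    intro g hg
    have hpsi : ∀ k, inner 𝕜 (ψ k) g = 0 := fun k =>
      (Submodule.mem_orthogonal _ _).1 hg (ψ k) (Submodule.subset_span ⟨k, rfl⟩)
    have h1 := hasSum_norm_inner_sq_of_orthogonal_total hc horth htot g
    have h2 : HasSum (fun k => ‖ψ k - φ k‖ ^ 2 * ‖g‖ ^ 2) (D * ‖g‖ ^ 2) :=
      hs.hasSum.mul_right _
    have h3 : c * ‖g‖ ^ 2 ≤ D * ‖g‖ ^ 2 := by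
      refine hasSum_le (fun k => ?_) h1 h2
      have h4 : inner 𝕜 (φ k) g = - inner 𝕜 (ψ k - φ k) g := by
        rw [inner_sub_left, hpsi, zero_sub, neg_neg]
      rw [h4, norm_neg, ← mul_pow]
      gcongr
      exact norm_inner_le_norm _ _
    by_contra hne
    have : 0 < ‖g‖ ^ 2 := by positivity
    nlinarith
  · intro N a
    set A := ∑ k ∈ Finset.range N, ‖a k‖ ^ 2 with hA
    have hA0 : 0 ≤ A := Finset.sum_nonneg fun _ _ => sq_nonneg _
    have h1 : ‖∑ k ∈ Finset.range N, a k • φ k‖ = √c * √A := by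
      rw [← Real.sqrt_mul hc.le, ← norm_sum_smul_sq_of_orthogonal horth,
        Real.sqrt_sq (norm_nonneg _)]
    have h2 := norm_sum_smul_le_of_summable_sq hs (Finset.range N) a
    rw [← hA, ← hDdef] at h2
    have h3 : ∑ k ∈ Finset.range N, a k • ψ k = ∑ k ∈ Finset.range N, a k • φ k
        + ∑ k ∈ Finset.range N, a k • (ψ k - φ k) := by
      rw [← Finset.sum_add_distrib]
      exact Finset.sum_congr rfl fun k _ => by rw [← smul_add, add_sub_cancel]
    have hup : ‖∑ k ∈ Finset.range N, a k • ψ k‖ ≤ (√c + √D) * √A := by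
      rw [h3]
      refine (norm_add_le _ _).trans ?_
      rw [h1]; linarith
    have hlo : (√c - √D) * √A ≤ ‖∑ k ∈ Finset.range N, a k • ψ k‖ := by
      rw [h3]
      have := norm_sub_le_norm_add (∑ k ∈ Finset.range N, a k • φ k)
        (∑ k ∈ Finset.range N, a k • (ψ k - φ k))
      rw [h1] at this
      linarith
    have hAs : √A ^ 2 = A := Real.sq_sqrt hA0
    constructor
    · calc (√c - √D) ^ 2 * A = ((√c - √D) * √A) ^ 2 := by rw [mul_pow, hAs]
        _ ≤ _ := pow_le_pow_left₀ (mul_nonneg (sub_pos.2 hsq).le (Real.sqrt_nonneg _)) hlo 2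
    · calc ‖∑ k ∈ Finset.range N, a k • ψ k‖ ^ 2 ≤ ((√c + √D) * √A) ^ 2 :=
            pow_le_pow_left₀ (norm_nonneg _) hup 2
        _ = _ := by rw [mul_pow, hAs]

end abstract

/-! ### Completeness and orthogonality of the sine system in L²(0, π). -/

section sine
variable {𝕜 : Type*} [RCLike 𝕜]

theorem integrable_mul_of_continuous {g : ℝ → 𝕜}
    (hg : Integrable g (volume.restrict (Ioo 0 π))) {h : ℝ → ℝ} (hh : Continuous h) :
    Integrable (fun x => (h x : 𝕜) * g x) (volume.restrict (Ioo 0 π)) := by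
  obtain ⟨C, hC⟩ := (isCompact_Icc (a := (0 : ℝ)) (b := π)).exists_bound_of_continuousOn
    hh.continuousOn
  refine Integrable.bdd_mul (c := C) hg
    (RCLike.continuous_ofReal.comp hh).aestronglyMeasurable ?_
  filter_upwards [ae_restrict_mem measurableSet_Ioo] with x hx
  rw [RCLike.norm_ofReal]
  exact hC x (Ioo_subset_Icc_self hx)

/-- Induction on k through 2 cos x sin((n+1)x) = sin((n+2)x) + sin(nx). Including the trivial
frequency 0 keeps the family closed under this step. -/
theorem integral_sin_mul_cos_pow_eq_zero {g : ℝ → 𝕜}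
    (hg : Integrable g (volume.restrict (Ioo 0 π)))
    (h : ∀ n : ℕ, ∫ x in Ioo 0 π, ((sin (n * x) : ℝ) : 𝕜) * g x = 0) (k n : ℕ) :
    ∫ x in Ioo 0 π, ((cos x ^ k * sin (n * x) : ℝ) : 𝕜) * g x = 0 := by
  induction k generalizing n with
  | zero => simpa using h n
  | succ k ih =>
    rcases n with _ | n
    · simp
    · have e : ∀ x : ℝ, ((cos x ^ (k + 1) * sin ((n + 1 : ℕ) * x) : ℝ) : 𝕜) * g x
          = ((1 / 2 : ℝ) : 𝕜) * (((cos x ^ k * sin ((n + 2 : ℕ) * x) : ℝ) : 𝕜) * g x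
            + ((cos x ^ k * sin (n * x) : ℝ) : 𝕜) * g x) := by
        intro x
        rw [← add_mul, ← RCLike.ofReal_add, ← mul_assoc, ← RCLike.ofReal_mul]
        congr 2
        have e1 : ((n + 2 : ℕ) : ℝ) * x = ((n + 1 : ℕ) : ℝ) * x + x := by push_cast; ring
        have e2 : (n : ℝ) * x = ((n + 1 : ℕ) : ℝ) * x - x := by push_cast; ring
        rw [e1, e2, sin_add, sin_sub]
        ring
      simp_rw [e]
      rw [integral_const_mul, integral_add, ih, ih]
      · simp
      · exact integrable_mul_of_continuous hg (by fun_prop)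
      · exact integrable_mul_of_continuous hg (by fun_prop)

theorem integral_polynomial_cos_mul_sin_eq_zero {g : ℝ → 𝕜}
    (hg : Integrable g (volume.restrict (Ioo 0 π)))
    (h : ∀ n : ℕ, ∫ x in Ioo 0 π, ((sin (n * x) : ℝ) : 𝕜) * g x = 0) (p : Polynomial ℝ) :
    ∫ x in Ioo 0 π, ((p.eval (cos x) * sin x : ℝ) : 𝕜) * g x = 0 := by
  induction p using Polynomial.induction_on' with
  | add p q hp hq =>
    simp_rw [Polynomial.eval_add, add_mul, RCLike.ofReal_add, add_mul]
    rw [integral_add, hp, hq, add_zero]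
    · exact integrable_mul_of_continuous hg (by fun_prop)
    · exact integrable_mul_of_continuous hg (by fun_prop)
  | monomial k a =>
    have e : ∀ x : ℝ, (((Polynomial.monomial k a).eval (cos x) * sin x : ℝ) : 𝕜) * g x
        = (a : 𝕜) * (((cos x ^ k * sin ((1 : ℕ) * x) : ℝ) : 𝕜) * g x) := by
      intro x
      rw [Polynomial.eval_monomial, Nat.cast_one, one_mul, mul_assoc a, RCLike.ofReal_mul,
        mul_assoc]
    simp_rw [e]
    rw [integral_const_mul, integral_sin_mul_cos_pow_eq_zero hg h, mul_zero]

/-- Since cos is a homeomorphism of [0, π] onto [-1, 1], Weierstrass approximation makes polynomials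
in cos x uniformly dense in C[0, π]. -/
theorem integral_continuous_mul_sin_eq_zero {g : ℝ → 𝕜}
    (hg : Integrable g (volume.restrict (Ioo 0 π)))
    (h : ∀ n : ℕ, ∫ x in Ioo 0 π, ((sin (n * x) : ℝ) : 𝕜) * g x = 0) {φ : ℝ → ℝ}
    (hφ : Continuous φ) :
    ∫ x in Ioo 0 π, ((φ x * sin x : ℝ) : 𝕜) * g x = 0 := by
  rw [← norm_le_zero_iff]
  refine le_of_forall_pos_le_add fun ε hε => ?_
  have hM : 0 ≤ ∫ x in Ioo 0 π, ‖g x‖ := integral_nonneg fun _ => norm_nonneg _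
  set M := ∫ x in Ioo 0 π, ‖g x‖ with hMdef
  -- The denominator is `M + 1` because the L¹ norm `M` of g may vanish.
  obtain ⟨p, hp⟩ := exists_polynomial_near_of_continuousOn (-1) 1 (fun y => φ (arccos y))
    (hφ.comp continuous_arccos).continuousOn (ε / (M + 1)) (by positivity)
  have hpi := integral_polynomial_cos_mul_sin_eq_zero hg h p
  have e : ∫ x in Ioo 0 π, ((φ x * sin x : ℝ) : 𝕜) * g x
      = ∫ x in Ioo 0 π, (((φ x - p.eval (cos x)) * sin x : ℝ) : 𝕜) * g x := by
    rw [← sub_zero (∫ x in Ioo 0 π, ((φ x * sin x : ℝ) : 𝕜) * g x), ← hpi, ← integral_sub]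
    · congr 1
      funext x
      push_cast; ring
    · exact integrable_mul_of_continuous hg (by fun_prop)
    · exact integrable_mul_of_continuous hg (by fun_prop)
  rw [e, zero_add]
  calc ‖∫ x in Ioo 0 π, (((φ x - p.eval (cos x)) * sin x : ℝ) : 𝕜) * g x‖
      ≤ ∫ x in Ioo 0 π, ε / (M + 1) * ‖g x‖ := by
        refine norm_integral_le_of_norm_le (hg.norm.const_mul _) ?_
        filter_upwards [ae_restrict_mem measurableSet_Ioo] with x hx
        rw [norm_mul, RCLike.norm_ofReal, abs_mul]
        gcongr
        have h1 := hp (cos x) ⟨neg_one_le_cos x, cos_le_one x⟩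
        rw [arccos_cos hx.1.le hx.2.le, abs_sub_comm] at h1
        calc |φ x - p.eval (cos x)| * |sin x| ≤ |φ x - p.eval (cos x)| * 1 := by
              gcongr; exact abs_sin_le_one x
          _ ≤ _ := by rw [mul_one]; exact h1.le
    _ = ε * (M / (M + 1)) := by rw [integral_const_mul]; ring
    _ ≤ ε * 1 := by
        gcongr
        rw [div_le_one (by positivity)]; linarith
    _ = ε := mul_one _

/-- The product g sin annihilates all test functions, hence vanishes almost everywhere, and sin has
no zero in (0, π). -/
theorem ae_eq_zero_of_integral_sin_mul_eq_zero {g : ℝ → 𝕜}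
    (hg : Integrable g (volume.restrict (Ioo 0 π)))
    (h : ∀ n : ℕ, ∫ x in Ioo 0 π, ((sin (n * x) : ℝ) : 𝕜) * g x = 0) :
    g =ᵐ[volume.restrict (Ioo 0 π)] 0 := by
  have h1 : ∀ᵐ x ∂(volume.restrict (Ioo 0 π)), ((sin x : ℝ) : 𝕜) * g x = 0 := by
    refine ae_eq_zero_of_integral_contDiff_smul_eq_zero
      (integrable_mul_of_continuous hg continuous_sin).locallyIntegrable fun φ hφ _ => ?_
    rw [← integral_continuous_mul_sin_eq_zero hg h hφ.continuous]
    congr 1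
    funext x
    rw [RCLike.real_smul_eq_coe_mul, RCLike.ofReal_mul, mul_assoc]
  filter_upwards [h1, ae_restrict_mem measurableSet_Ioo] with x hx hx'
  have : ((sin x : ℝ) : 𝕜) ≠ 0 := by
    exact_mod_cast (sin_pos_of_pos_of_lt_pi hx'.1 hx'.2).ne'
  exact (mul_eq_zero.1 hx).resolve_left this

theorem memLp_ofReal_of_continuousOn {u : ℝ → ℝ} (hu : ContinuousOn u (Icc 0 π)) :
    MemLp (fun x => (u x : 𝕜)) 2 (volume.restrict (Ioo 0 π)) := by
  obtain ⟨C, hC⟩ := (isCompact_Icc (a := (0 : ℝ)) (b := π)).exists_bound_of_continuousOn hu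
  have hm : AEStronglyMeasurable (fun x => (u x : 𝕜)) (volume.restrict (Ioo 0 π)) :=
    (RCLike.continuous_ofReal.comp_continuousOn
      (hu.mono Ioo_subset_Icc_self)).aestronglyMeasurable measurableSet_Ioo
  refine MemLp.of_bound hm C ?_
  filter_upwards [ae_restrict_mem measurableSet_Ioo] with x hx
  rw [RCLike.norm_ofReal]
  exact hC x (Ioo_subset_Icc_self hx)

theorem norm_toLp_ofReal_sub_sq {u v : ℝ → ℝ} (hu : ContinuousOn u (Icc 0 π))
    (hv : ContinuousOn v (Icc 0 π)) :
    ‖(memLp_ofReal_of_continuousOn (𝕜 := 𝕜) hu).toLp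
        - (memLp_ofReal_of_continuousOn (𝕜 := 𝕜) hv).toLp‖ ^ 2
      = ∫ x in 0..π, (u x - v x) ^ 2 := by
  rw [← MemLp.toLp_sub, ← RCLike.ofReal_inj (K := 𝕜), RCLike.ofReal_pow,
    ← inner_self_eq_norm_sq_to_K (𝕜 := 𝕜), L2.inner_def,
    intervalIntegral.integral_of_le pi_pos.le, integral_Ioc_eq_integral_Ioo, ← integral_ofReal]
  refine integral_congr_ae ?_
  filter_upwards [MemLp.coeFn_toLp ((memLp_ofReal_of_continuousOn (𝕜 := 𝕜) hu).sub
    (memLp_ofReal_of_continuousOn (𝕜 := 𝕜) hv))] with x hx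
  rw [hx, Pi.sub_apply, RCLike.inner_apply, ← RCLike.ofReal_sub, RCLike.conj_ofReal,
    ← RCLike.ofReal_mul, sq]

theorem inner_toLp_ofReal {u v : ℝ → ℝ} (hu : ContinuousOn u (Icc 0 π))
    (hv : ContinuousOn v (Icc 0 π)) :
    inner 𝕜 (memLp_ofReal_of_continuousOn (𝕜 := 𝕜) hu).toLp
        (memLp_ofReal_of_continuousOn (𝕜 := 𝕜) hv).toLp
      = ((∫ x in 0..π, u x * v x : ℝ) : 𝕜) := by
  rw [L2.inner_def,
    intervalIntegral.integral_of_le pi_pos.le, integral_Ioc_eq_integral_Ioo, ← integral_ofReal]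
  refine integral_congr_ae ?_
  filter_upwards [MemLp.coeFn_toLp (memLp_ofReal_of_continuousOn (𝕜 := 𝕜) hu),
    MemLp.coeFn_toLp (memLp_ofReal_of_continuousOn (𝕜 := 𝕜) hv)] with x hx hx'
  rw [hx, hx', RCLike.inner_apply, RCLike.conj_ofReal, ← RCLike.ofReal_mul, mul_comm]

theorem continuousOn_sin_natCast_mul (n : ℕ) :
    ContinuousOn (fun x : ℝ => sin (n * x)) (Icc 0 π) := by fun_prop

variable (𝕜) in
/-- The function `x ↦ sin ((k + 1) x)` as an element of `L²(0, π)`. -/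
noncomputable def sineLp (k : ℕ) : Lp 𝕜 2 (volume.restrict (Ioo 0 π)) :=
  (memLp_ofReal_of_continuousOn (𝕜 := 𝕜) (continuousOn_sin_natCast_mul (k + 1))).toLp

theorem integral_sin_nat_mul_sin_nat (i j : ℕ) :
    ∫ x in 0..π, sin ((i + 1 : ℕ) * x) * sin ((j + 1 : ℕ) * x) = if i = j then π / 2 else 0 := by
  have key : ∀ m : ℤ, m ≠ 0 → ∫ x in 0..π, cos (m * x) = 0 := by
    intro m hm
    have hm' : (m : ℝ) ≠ 0 := by exact_mod_cast hm
    rw [intervalIntegral.integral_comp_mul_left (fun x => cos x) hm', integral_cos,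
      sin_int_mul_pi]
    simp
  have e : ∀ x : ℝ, sin ((i + 1 : ℕ) * x) * sin ((j + 1 : ℕ) * x)
      = (1 / 2) * (cos (((i : ℤ) - j : ℤ) * x) - cos (((i : ℤ) + j + 2 : ℤ) * x)) := by
    intro x
    have e1 : (((i : ℤ) - j : ℤ) : ℝ) * x = (i + 1 : ℕ) * x - (j + 1 : ℕ) * x := by
      push_cast; ring
    have e2 : (((i : ℤ) + j + 2 : ℤ) : ℝ) * x = (i + 1 : ℕ) * x + (j + 1 : ℕ) * x := by
      push_cast; ring
    rw [e1, e2, cos_add, cos_sub]; ring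
  simp_rw [e]
  rw [intervalIntegral.integral_const_mul, intervalIntegral.integral_sub
    (Continuous.intervalIntegrable (by fun_prop) _ _)
    (Continuous.intervalIntegrable (by fun_prop) _ _), key ((i : ℤ) + j + 2) (by omega)]
  split_ifs with hij
  · rw [hij]; simp; ring
  · rw [key _ (by omega)]; simp

theorem inner_sineLp (i j : ℕ) :
    inner 𝕜 (sineLp 𝕜 i) (sineLp 𝕜 j) = if i = j then ((π / 2 : ℝ) : 𝕜) else 0 := by
  rw [sineLp, sineLp, inner_toLp_ofReal (continuousOn_sin_natCast_mul _)
    (continuousOn_sin_natCast_mul _), integral_sin_nat_mul_sin_nat]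
  split_ifs <;> simp

theorem eq_zero_of_inner_sineLp_eq_zero (g : Lp 𝕜 2 (volume.restrict (Ioo 0 π)))
    (h : ∀ k, inner 𝕜 (sineLp 𝕜 k) g = 0) : g = 0 := by
  have hg : Integrable g (volume.restrict (Ioo 0 π)) := (Lp.memLp g).integrable one_le_two
  rw [Lp.eq_zero_iff_ae_eq_zero]
  refine ae_eq_zero_of_integral_sin_mul_eq_zero hg fun n => ?_
  rcases n with _ | k
  · simp
  · rw [← h k, L2.inner_def]
    refine integral_congr_ae ?_
    filter_upwards [MemLp.coeFn_toLp (memLp_ofReal_of_continuousOn (𝕜 := 𝕜)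
      (continuousOn_sin_natCast_mul (k + 1)))] with x hx
    rw [sineLp, hx, RCLike.inner_apply, RCLike.conj_ofReal, mul_comm]

end sine

/-! ### Fučík eigenfunctions as chains of sine arches. -/

section ode
variable {α β : ℝ} {u : ℝ → ℝ}

theorem IsFucikSolution.hasDerivWithinAt (h : IsFucikSolution α β u) {x : ℝ}
    (hx : x ∈ Icc 0 π) : HasDerivWithinAt u (derivWithin u (Icc 0 π) x) (Icc 0 π) x :=
  ((h.contDiffOn.differentiableOn (by norm_num)) x hx).hasDerivWithinAt

/-- The equation is given only in the open interval; both sides are continuous on [0, π], so it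
extends to the endpoints with one-sided derivatives. -/
theorem IsFucikSolution.hasDerivWithinAt_derivWithin (h : IsFucikSolution α β u) {x : ℝ}
    (hx : x ∈ Icc 0 π) : HasDerivWithinAt (derivWithin u (Icc 0 π))
      (-(α * max (u x) 0 - β * max (-u x) 0)) (Icc 0 π) x := by
  have huniq : UniqueDiffOn ℝ (Icc 0 π) := uniqueDiffOn_Icc pi_pos
  have hv : ContDiffOn ℝ 1 (derivWithin u (Icc 0 π)) (Icc 0 π) :=
    h.contDiffOn.derivWithin huniq (by norm_num)
  have hw : ContinuousOn (derivWithin (derivWithin u (Icc 0 π)) (Icc 0 π)) (Icc 0 π) :=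
    hv.continuousOn_derivWithin huniq (by norm_num)
  have hu : ContinuousOn u (Icc 0 π) := h.contDiffOn.continuousOn
  have heq : EqOn (derivWithin (derivWithin u (Icc 0 π)) (Icc 0 π))
      (fun x => -(α * max (u x) 0 - β * max (-u x) 0)) (Icc 0 π) := by
    refine EqOn.of_subset_closure (s := Ioo 0 π) (fun y hy => ?_) hw (by fun_prop)
      Ioo_subset_Icc_self (by rw [closure_Ioo pi_pos.ne])
    have hn : Icc 0 π ∈ nhds y := Icc_mem_nhds hy.1 hy.2
    have hev : derivWithin u (Icc 0 π) =ᶠ[nhds y] deriv u := by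
      filter_upwards [Ioo_mem_nhds hy.1 hy.2] with z hz
      exact derivWithin_of_mem_nhds (Icc_mem_nhds hz.1 hz.2)
    rw [derivWithin_of_mem_nhds hn, hev.deriv_eq]
    have := h.equation y hy
    linarith
  have := ((hv.differentiableOn (by norm_num)) x hx).hasDerivWithinAt
  rwa [heq hx] at this

/-- The nonlinearity is not smooth at 0 but is globally Lipschitz, which is all that uniqueness of
solutions requires. -/
theorem exists_lipschitzWith_fucik_field (α β : ℝ) : ∃ K, LipschitzWith K
    (fun y : ℝ × ℝ => (y.2, -(α * max y.1 0 - β * max (-y.1) 0))) := by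
  have h1 : LipschitzWith 1 (fun y : ℝ => max y 0) := LipschitzWith.id.max_const 0
  have h2 : LipschitzWith 1 (fun y : ℝ => max (-y) 0) :=
    (LipschitzWith.id (α := ℝ)).neg.max_const 0
  have h3 := (lipschitzWith_smul α).comp h1
  have h4 := (lipschitzWith_smul β).comp h2
  exact ⟨_, LipschitzWith.prod_snd.prodMk (((h3.sub h4).neg).comp LipschitzWith.prod_fst)⟩

/-- On an interval of length `π / ω` starting at a zero `a` with slope `σ p`, the solution is an
arch of a sine with frequency `ω`. -/
theorem IsFucikSolution.eqOn_arch (h : IsFucikSolution α β u) {a p σ ω : ℝ} (ha : 0 ≤ a)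
    (hω : 0 < ω) (hb : a + π / ω ≤ π) (hp : 0 < p)
    (hF : ∀ y, 0 ≤ y → α * max (σ * y) 0 - β * max (-(σ * y)) 0 = ω ^ 2 * (σ * y))
    (h0 : u a = 0) (h1 : derivWithin u (Icc 0 π) a = σ * p) :
    (∀ x ∈ Icc a (a + π / ω), u x = σ * (p / ω * sin (ω * (x - a)))) ∧
      derivWithin u (Icc 0 π) (a + π / ω) = -(σ * p) := by
  obtain ⟨K, hK⟩ := exists_lipschitzWith_fucik_field α β
  have hL : 0 < π / ω := div_pos pi_pos hω
  have hsub : ∀ {x}, x ∈ Icc a (a + π / ω) → x ∈ Icc 0 π := fun hx =>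
    ⟨ha.trans hx.1, hx.2.trans hb⟩
  have hd1 : ∀ x, HasDerivAt (fun x => σ * (p / ω * sin (ω * (x - a))))
      (σ * (p * cos (ω * (x - a)))) x := by
    intro x
    have := (((((hasDerivAt_id x).sub_const a).const_mul ω).sin).const_mul (p / ω)).const_mul σ
    refine this.congr_deriv ?_
    simp only [id]
    field_simp
  have hd2 : ∀ x, HasDerivAt (fun x => σ * (p * cos (ω * (x - a))))
      (-(ω ^ 2 * (σ * (p / ω * sin (ω * (x - a)))))) x := by
    intro x
    have := (((((hasDerivAt_id x).sub_const a).const_mul ω).cos).const_mul p).const_mul σ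
    refine this.congr_deriv ?_
    simp only [id]
    field_simp
  have key : EqOn (fun x => (u x, derivWithin u (Icc 0 π) x))
      (fun x => (σ * (p / ω * sin (ω * (x - a))), σ * (p * cos (ω * (x - a)))))
      (Icc a (a + π / ω)) := by
    have hnhds : ∀ x ∈ Ico a (a + π / ω), Icc 0 π ∈ nhdsWithin x (Ici x) := fun x hx =>
      Filter.mem_of_superset (Icc_mem_nhdsGE (hx.2.trans_le hb))
        (Icc_subset_Icc_left (ha.trans hx.1))
    -- The explicit sine keeps one sign on the arch, so by `hF` it solves the nonlinear system for
    -- (u, u') with the same initial data.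
    refine ODE_solution_unique (v := fun _ y => (y.2, -(α * max y.1 0 - β * max (-y.1) 0)))
      (fun _ => hK) ?_ ?_ ?_ ?_ ?_
    · intro x hx
      exact ((h.hasDerivWithinAt (hsub hx)).continuousWithinAt.prodMk
        (h.hasDerivWithinAt_derivWithin (hsub hx)).continuousWithinAt).mono fun y hy => hsub hy
    · intro x hx
      have hx' := hsub (Ico_subset_Icc_self hx)
      exact ((h.hasDerivWithinAt hx').mono_of_mem_nhdsWithin (hnhds x hx)).prodMk
        ((h.hasDerivWithinAt_derivWithin hx').mono_of_mem_nhdsWithin (hnhds x hx))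
    · exact Continuous.continuousOn (by fun_prop)
    · intro x hx
      have hs : 0 ≤ p / ω * sin (ω * (x - a)) := by
        refine mul_nonneg (div_pos hp hω).le (sin_nonneg_of_nonneg_of_le_pi
          (mul_nonneg hω.le (sub_nonneg.2 hx.1)) ?_)
        rw [← le_div_iff₀' hω]; linarith [hx.2]
      have h3 := (hd1 x).hasDerivWithinAt (s := Ici x) |>.prodMk
        ((hd2 x).hasDerivWithinAt (s := Ici x))
      simp only [hF _ hs]
      exact h3
    · simp [h0, h1]
  refine ⟨fun x hx => congrArg Prod.fst (key hx), ?_⟩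
  have h5 := congrArg Prod.snd (key (right_mem_Icc.2 (le_add_of_nonneg_right hL.le)))
  simp only [add_sub_cancel_left, mul_div_cancel₀ _ hω.ne', cos_pi] at h5
  rw [h5]; ring

/-- Frequency of the `i`-th arch of a Fučík eigenfunction. -/
noncomputable def archFreq (α β : ℝ) (i : ℕ) : ℝ := if Even i then √α else √β

/-- Left end of the `i`-th arch of a Fučík eigenfunction. -/
noncomputable def archZero (α β : ℝ) (i : ℕ) : ℝ := ∑ j ∈ Finset.range i, π / archFreq α β j

theorem archZero_zero : archZero α β 0 = 0 := by simp [archZero]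

theorem archZero_succ (i : ℕ) :
    archZero α β (i + 1) = archZero α β i + π / archFreq α β i := by
  simp [archZero, Finset.sum_range_succ]

theorem archFreq_pos (hα : 0 < α) (hβ : 0 < β) (i : ℕ) : 0 < archFreq α β i := by
  unfold archFreq
  split_ifs <;> exact Real.sqrt_pos.2 (by assumption)

theorem archZero_mono (hα : 0 < α) (hβ : 0 < β) : Monotone (archZero α β) :=
  monotone_nat_of_le_succ fun i => by
    rw [archZero_succ]
    linarith [div_pos pi_pos (archFreq_pos hα hβ i)]

theorem archZero_nonneg (hα : 0 < α) (hβ : 0 < β) (i : ℕ) : 0 ≤ archZero α β i := by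
  simpa [archZero_zero] using archZero_mono hα hβ (Nat.zero_le i)

theorem fucik_nonlinearity_arch (hα : 0 < α) (hβ : 0 < β) (i : ℕ) (y : ℝ) (hy : 0 ≤ y) :
    α * max ((-1) ^ i * y) 0 - β * max (-((-1) ^ i * y)) 0
      = archFreq α β i ^ 2 * ((-1) ^ i * y) := by
  unfold archFreq
  split_ifs with hi
  · rw [hi.neg_one_pow, one_mul, max_eq_left hy, max_eq_right (by linarith), sq_sqrt hα.le]
    ring
  · rw [(Nat.not_even_iff_odd.1 hi).neg_one_pow, neg_one_mul, neg_neg, max_eq_left hy,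
      max_eq_right (by linarith), sq_sqrt hβ.le]
    ring

/-- A sine arch ends with the opposite of its initial slope, whatever its frequency; the absolute
slope p therefore propagates through all zeros. -/
theorem IsFucikSolution.zero_and_slope_at_archZero (h : IsFucikSolution α β u) (hα : 0 < α)
    (hβ : 0 < β) {p : ℝ} (hp : 0 < p) (h1 : derivWithin u (Icc 0 π) 0 = p) (i : ℕ)
    (hi : archZero α β i ≤ π) :
    u (archZero α β i) = 0 ∧ derivWithin u (Icc 0 π) (archZero α β i) = (-1) ^ i * p := by
  induction i with
  | zero => simp [archZero_zero, h.left, h1]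
  | succ i ih =>
    have hw := archFreq_pos hα hβ i
    obtain ⟨ih1, ih2⟩ := ih ((archZero_mono hα hβ (Nat.le_succ i)).trans hi)
    rw [archZero_succ] at hi ⊢
    obtain ⟨e1, e2⟩ := h.eqOn_arch (archZero_nonneg hα hβ i) hw hi hp
      (fucik_nonlinearity_arch hα hβ i) ih1 ih2
    refine ⟨?_, by rw [e2, pow_succ]; ring⟩
    rw [e1 _ (right_mem_Icc.2 (le_add_of_nonneg_right (div_pos pi_pos hw).le)),
      add_sub_cancel_left, mul_div_cancel₀ _ hw.ne', sin_pi]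
    simp

theorem IsFucikSolution.eq_on_arch (h : IsFucikSolution α β u) (hα : 0 < α)
    (hβ : 0 < β) {p : ℝ} (hp : 0 < p) (h1 : derivWithin u (Icc 0 π) 0 = p) (i : ℕ)
    (hi : archZero α β (i + 1) ≤ π) {x : ℝ}
    (hx : x ∈ Icc (archZero α β i) (archZero α β (i + 1))) :
    u x = (-1) ^ i * (p / archFreq α β i * sin (archFreq α β i * (x - archZero α β i))) := by
  have hw := archFreq_pos hα hβ i
  obtain ⟨ih1, ih2⟩ := h.zero_and_slope_at_archZero hα hβ hp h1 i
    ((archZero_mono hα hβ (Nat.le_succ i)).trans hi)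
  rw [archZero_succ] at hi hx
  exact (h.eqOn_arch (archZero_nonneg hα hβ i) hw hi hp
      (fucik_nonlinearity_arch hα hβ i) ih1 ih2).1 x hx

theorem exists_mem_arch (n : ℕ) {x : ℝ} (h0 : 0 ≤ x) (hx : x ≤ archZero α β n)
    (hn : 0 < n) : ∃ i < n, x ∈ Icc (archZero α β i) (archZero α β (i + 1)) := by
  induction n with
  | zero => omega
  | succ n ih =>
    rcases le_total (archZero α β n) x with h | h
    · exact ⟨n, n.lt_succ_self, h, hx⟩
    · rcases Nat.eq_zero_or_pos n with rfl | hn'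
      · exact ⟨0, by omega, by rwa [archZero_zero], hx⟩
      · obtain ⟨i, hi, hi'⟩ := ih h hn'
        exact ⟨i, by omega, hi'⟩

/-- The slope at `0` of a normalized Fučík eigenfunction with at least two arches. -/
theorem IsNormalizedFucikEigenfunction.derivWithin_zero
    (h : IsNormalizedFucikEigenfunction α β u) (hα : 0 < α) (hβ : 0 < β) {n : ℕ} (hn : 2 ≤ n)
    (hz : archZero α β n = π) : derivWithin u (Icc 0 π) 0 = min (√α) (√β) := by
  have hp := h.slope_pos
  set p := derivWithin u (Icc 0 π) 0 with hpdef
  have hsα := Real.sqrt_pos.2 hα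
  have hsβ := Real.sqrt_pos.2 hβ
  have hle : ∀ i, i < n → archZero α β (i + 1) ≤ π := fun i hi => by
    rw [← hz]; exact archZero_mono hα hβ hi
  have hattain : ∀ i, i < n → p / archFreq α β i ≤ 1 := by
    intro i hi
    have hw := archFreq_pos hα hβ i
    have hL := div_pos pi_pos hw
    -- At the midpoint of an arch |u| equals its amplitude p/ω, so the supremum bound limits p. As n
    -- ≥ 2, both frequencies occur.
    have hmem : archZero α β i + π / archFreq α β i / 2
        ∈ Icc (archZero α β i) (archZero α β (i + 1)) := by
      rw [archZero_succ]; constructor <;> linarith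
    have h1 := h.norm_one.1 ⟨_, ⟨(archZero_nonneg hα hβ i).trans hmem.1,
      hmem.2.trans (hle i hi)⟩, rfl⟩
    have h2 : archFreq α β i * (π / archFreq α β i / 2) = π / 2 := by field_simp
    simp only at h1
    rwa [h.solution.eq_on_arch hα hβ hp rfl i (hle i hi) hmem, add_sub_cancel_left, h2,
      sin_pi_div_two, abs_mul, abs_pow, abs_neg, abs_one, one_pow, one_mul, mul_one,
      abs_of_pos (div_pos hp hw)] at h1
  have e0 : archFreq α β 0 = √α := by simp [archFreq]
  have e1 : archFreq α β 1 = √β := by simp [archFreq]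
  have h0 := hattain 0 (by omega)
  have h1 := hattain 1 (by omega)
  rw [e0, div_le_one hsα] at h0
  rw [e1, div_le_one hsβ] at h1
  refine le_antisymm (le_min h0 h1) ?_
  have hm : 0 < min (√α) (√β) := lt_min hsα hsβ
  -- Conversely, p divided by the smaller frequency bounds |u| on every arch, so it is at least the
  -- least upper bound 1.
  rw [← one_le_div₀ hm]
  refine h.norm_one.2 ?_
  rintro _ ⟨x, hx, rfl⟩
  obtain ⟨i, hi, hxi⟩ := exists_mem_arch n hx.1 (hz.symm ▸ hx.2) (by omega)
  have hw := archFreq_pos hα hβ i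
  simp only
  rw [h.solution.eq_on_arch hα hβ hp rfl i (hle i hi) hxi, abs_mul, abs_pow, abs_neg, abs_one,
    one_pow, one_mul, abs_mul, abs_of_pos (div_pos hp hw)]
  calc p / archFreq α β i * |sin (archFreq α β i * (x - archZero α β i))|
      ≤ p / archFreq α β i * 1 := by
        gcongr
        exact abs_sin_le_one _
    _ ≤ p / min (√α) (√β) := by
        rw [mul_one]
        gcongr
        unfold archFreq
        split_ifs
        · exact min_le_left _ _
        · exact min_le_right _ _

end ode

/-! ### Integrals over arches and their sums. -/

section arches
variable {α β : ℝ} {u : ℝ → ℝ}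

theorem integral_sq_arch {ω : ℝ} (hω : 0 < ω) (a p : ℝ) :
    ∫ x in a..a + π / ω, (p / ω * sin (ω * (x - a))) ^ 2 = (p / ω) ^ 2 * (π / ω) / 2 := by
  simp_rw [mul_pow]
  rw [intervalIntegral.integral_const_mul,
    intervalIntegral.integral_comp_sub_right (fun y => sin (ω * y) ^ 2),
    intervalIntegral.integral_comp_mul_left (fun y => sin y ^ 2) hω.ne', integral_sin_sq,
    sub_self, mul_zero, add_sub_cancel_left, mul_div_cancel₀ _ hω.ne', sin_pi, sin_zero,
    smul_eq_mul]
  field_simp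
  ring

/-- Lagrange's identity: the Wronskian of the arch and sin(Nx) has derivative (ω² − N²) times their
product. Only the slopes ±p of the arch survive at the ends. -/
theorem integral_arch_mul_sin {ω N : ℝ} (hω : 0 < ω) (hN : ω ^ 2 ≠ N ^ 2) (a p : ℝ) :
    ∫ x in a..a + π / ω, p / ω * sin (ω * (x - a)) * sin (N * x)
      = p * (sin (N * a) + sin (N * (a + π / ω))) / (ω ^ 2 - N ^ 2) := by
  have hne : ω ^ 2 - N ^ 2 ≠ 0 := sub_ne_zero.2 hN
  have hd : ∀ x, HasDerivAt (fun x => p / ω / (ω ^ 2 - N ^ 2) *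
      (sin (ω * (x - a)) * (N * cos (N * x)) - ω * cos (ω * (x - a)) * sin (N * x)))
      (p / ω * sin (ω * (x - a)) * sin (N * x)) x := by
    intro x
    have h1 := (((hasDerivAt_id x).sub_const a).const_mul ω).sin
    have h2 := (((hasDerivAt_id x).sub_const a).const_mul ω).cos
    have h3 := ((hasDerivAt_id x).const_mul N).sin
    have h4 := ((hasDerivAt_id x).const_mul N).cos
    refine (((h1.mul (h4.const_mul N)).sub ((h2.const_mul ω).mul h3)).const_mul
      (p / ω / (ω ^ 2 - N ^ 2))).congr_deriv ?_
    simp only [id]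
    field_simp
    ring
  rw [intervalIntegral.integral_eq_sub_of_hasDerivAt (fun x _ => hd x)
    (Continuous.intervalIntegrable (by fun_prop) _ _)]
  simp only [add_sub_cancel_left, mul_div_cancel₀ _ hω.ne', sin_pi, cos_pi, sub_self, mul_zero,
    sin_zero, cos_zero]
  field_simp
  ring

theorem integral_eq_sum_arches {g : ℝ → ℝ} (hg : ContinuousOn g (Icc 0 π)) (hα : 0 < α)
    (hβ : 0 < β) {n : ℕ} (hz : archZero α β n = π) :
    ∫ x in 0..π, g x
      = ∑ i ∈ Finset.range n, ∫ x in archZero α β i..archZero α β (i + 1), g x := by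
  rw [intervalIntegral.sum_integral_adjacent_intervals, archZero_zero, hz]
  intro k hk
  have hm := archZero_mono hα hβ (Nat.le_succ k)
  refine ContinuousOn.intervalIntegrable ?_
  rw [uIcc_of_le hm]
  exact hg.mono (Icc_subset_Icc (archZero_nonneg hα hβ k) (hz ▸ archZero_mono hα hβ hk))

theorem IsFucikSolution.integral_sq (h : IsFucikSolution α β u) (hα : 0 < α)
    (hβ : 0 < β) {p : ℝ} (hp : 0 < p) (h1 : derivWithin u (Icc 0 π) 0 = p) {n : ℕ}
    (hz : archZero α β n = π) :
    ∫ x in 0..π, u x ^ 2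
      = ∑ i ∈ Finset.range n, (p / archFreq α β i) ^ 2 * (π / archFreq α β i) / 2 := by
  rw [integral_eq_sum_arches (g := fun x => u x ^ 2) (h.contDiffOn.continuousOn.pow 2) hα hβ hz]
  refine Finset.sum_congr rfl fun i hi => ?_
  have hi' : archZero α β (i + 1) ≤ π :=
    hz ▸ archZero_mono hα hβ (Finset.mem_range.1 hi)
  rw [← integral_sq_arch (archFreq_pos hα hβ i) (archZero α β i) p, ← archZero_succ]
  refine intervalIntegral.integral_congr fun x hx => ?_
  rw [uIcc_of_le (archZero_mono hα hβ (Nat.le_succ i))] at hx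
  rw [h.eq_on_arch hα hβ hp h1 i hi' hx, mul_pow, ← pow_mul, mul_comm i, pow_mul]
  simp

theorem IsFucikSolution.integral_mul_sin (h : IsFucikSolution α β u) (hα : 0 < α)
    (hβ : 0 < β) {p : ℝ} (hp : 0 < p) (h1 : derivWithin u (Icc 0 π) 0 = p) {n : ℕ}
    (hz : archZero α β n = π) {N : ℝ} (hN : ∀ i, archFreq α β i ^ 2 ≠ N ^ 2) :
    ∫ x in 0..π, u x * sin (N * x)
      = p * ∑ i ∈ Finset.range n, (-1) ^ i * (sin (N * archZero α β i)
          + sin (N * archZero α β (i + 1))) / (archFreq α β i ^ 2 - N ^ 2) := by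
  rw [integral_eq_sum_arches (g := fun x => u x * sin (N * x))
    (h.contDiffOn.continuousOn.mul (by fun_prop)) hα hβ hz,
    Finset.mul_sum]
  refine Finset.sum_congr rfl fun i hi => ?_
  have hi' : archZero α β (i + 1) ≤ π :=
    hz ▸ archZero_mono hα hβ (Finset.mem_range.1 hi)
  have e := integral_arch_mul_sin (archFreq_pos hα hβ i) (hN i) (archZero α β i) p
  rw [← archZero_succ] at e
  have e2 : p * ((-1) ^ i * (sin (N * archZero α β i)
          + sin (N * archZero α β (i + 1))) / (archFreq α β i ^ 2 - N ^ 2))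
      = (-1) ^ i * (p * (sin (N * archZero α β i) + sin (N * archZero α β (i + 1)))
          / (archFreq α β i ^ 2 - N ^ 2)) := by ring
  rw [e2, ← e, ← intervalIntegral.integral_const_mul]
  refine intervalIntegral.integral_congr fun x hx => ?_
  rw [uIcc_of_le (archZero_mono hα hβ (Nat.le_succ i))] at hx
  rw [h.eq_on_arch hα hβ hp h1 i hi' hx]
  ring

theorem archFreq_two_mul (j : ℕ) : archFreq α β (2 * j) = √α := by simp [archFreq]

theorem archFreq_two_mul_add_one (j : ℕ) : archFreq α β (2 * j + 1) = √β := by simp [archFreq]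

theorem archZero_two_mul (j : ℕ) : archZero α β (2 * j) = j * (π / √α + π / √β) := by
  induction j with
  | zero => simp [archZero]
  | succ j ih =>
    rw [show 2 * (j + 1) = 2 * j + 1 + 1 by ring, archZero_succ, archZero_succ, ih,
      archFreq_two_mul, archFreq_two_mul_add_one]
    push_cast; ring

theorem archZero_two_mul_add_one (j : ℕ) :
    archZero α β (2 * j + 1) = j * (π / √α + π / √β) + π / √α := by
  rw [archZero_succ, archZero_two_mul, archFreq_two_mul]

theorem sum_range_two_mul {M : Type*} [AddCommMonoid M] (g : ℕ → M) (m : ℕ) :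
    ∑ i ∈ Finset.range (2 * m), g i
      = ∑ j ∈ Finset.range m, (g (2 * j) + g (2 * j + 1)) := by
  induction m with
  | zero => simp
  | succ m ih =>
    rw [show 2 * (m + 1) = 2 * m + 1 + 1 by ring, Finset.sum_range_succ, Finset.sum_range_succ,
      ih, Finset.sum_range_succ, add_assoc]

theorem sum_comp_archFreq_even (g : ℝ → ℝ) (m : ℕ) :
    ∑ i ∈ Finset.range (2 * m), g (archFreq α β i) = m * g (√α) + m * g (√β) := by
  rw [sum_range_two_mul]
  simp only [archFreq_two_mul, archFreq_two_mul_add_one, Finset.sum_const, Finset.card_range,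
    nsmul_eq_mul]
  ring

theorem sum_comp_archFreq_odd (g : ℝ → ℝ) (m : ℕ) :
    ∑ i ∈ Finset.range (2 * m + 1), g (archFreq α β i) = (m + 1) * g (√α) + m * g (√β) := by
  rw [Finset.sum_range_succ, sum_comp_archFreq_even, archFreq_two_mul]
  ring

/-- With N = 2m, the zeros of even index satisfy N z = 2jπ and contribute nothing, while those of
odd index all give Nπ/√α modulo 2π. In use, `c` is ω ↦ ω² − N². -/
theorem sum_sin_archZero_even {m : ℕ} (hz : m * (π / √α + π / √β) = π) (c : ℝ → ℝ) :
    ∑ i ∈ Finset.range (2 * m), (-1) ^ i * (sin ((2 * m : ℕ) * archZero α β i)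
        + sin ((2 * m : ℕ) * archZero α β (i + 1))) / c (archFreq α β i)
      = m * sin ((2 * m : ℕ) * (π / √α)) * (1 / c (√α) - 1 / c (√β)) := by
  have h0 : ∀ j : ℕ, sin ((2 * m : ℕ) * archZero α β (2 * j)) = 0 := by
    intro j
    rw [archZero_two_mul, show ((2 * m : ℕ) : ℝ) * (j * (π / √α + π / √β)) = (2 * j : ℕ) * π by
      push_cast; linear_combination (2 * j : ℝ) * hz]
    exact sin_nat_mul_pi _
  have h1 : ∀ j : ℕ, sin ((2 * m : ℕ) * archZero α β (2 * j + 1))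
      = sin ((2 * m : ℕ) * (π / √α)) := by
    intro j
    rw [archZero_two_mul_add_one, show ((2 * m : ℕ) : ℝ) * (j * (π / √α + π / √β) + π / √α)
      = (2 * m : ℕ) * (π / √α) + j * (2 * π) by
        push_cast; linear_combination (2 * j : ℝ) * hz]
    exact sin_add_nat_mul_two_pi _ _
  rw [sum_range_two_mul]
  have h2 : ∀ j : ℕ, 2 * j + 1 + 1 = 2 * (j + 1) := fun j => by ring
  have h3 : ∀ j : ℕ, (-1 : ℝ) ^ (2 * j) = 1 := fun j => (even_two_mul j).neg_one_pow
  have h4 : ∀ j : ℕ, (-1 : ℝ) ^ (2 * j + 1) = -1 := fun j => (odd_two_mul_add_one j).neg_one_pow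
  simp only [h2, h0, h1, h3, h4, archFreq_two_mul, archFreq_two_mul_add_one, Finset.sum_const, Finset.card_range, nsmul_eq_mul]
  ring

/-- With η = π/√β − π/√α and N = 2m + 1, modulo 2π the zeros give N z = jη for even index 2j and π −
(m − j)η for index 2j + 1. Hence the positive arches and the negative arches each collect every
sin(jη) twice. -/
theorem sum_sin_archZero_odd {m : ℕ} (hz : (m + 1) * (π / √α) + m * (π / √β) = π) (c : ℝ → ℝ) :
    ∑ i ∈ Finset.range (2 * m + 1), (-1) ^ i * (sin ((2 * m + 1 : ℕ) * archZero α β i)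
        + sin ((2 * m + 1 : ℕ) * archZero α β (i + 1))) / c (archFreq α β i)
      = 2 * (∑ j ∈ Finset.range (m + 1), sin (j * (π / √β - π / √α)))
        * (1 / c (√α) - 1 / c (√β)) := by
  set η := π / √β - π / √α with hη
  have h0 : ∀ j : ℕ, sin ((2 * m + 1 : ℕ) * archZero α β (2 * j)) = sin (j * η) := by
    intro j
    rw [archZero_two_mul, show ((2 * m + 1 : ℕ) : ℝ) * (j * (π / √α + π / √β))
      = j * η + j * (2 * π) by
        rw [hη]; push_cast; linear_combination (2 * j : ℝ) * hz]
    exact sin_add_nat_mul_two_pi _ _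
  have h1 : ∀ j : ℕ, sin ((2 * m + 1 : ℕ) * archZero α β (2 * j + 1)) = sin ((m - j) * η) := by
    intro j
    rw [archZero_two_mul_add_one,
      show ((2 * m + 1 : ℕ) : ℝ) * (j * (π / √α + π / √β) + π / √α)
      = (π - (m - j) * η) + j * (2 * π) by
        rw [hη]; push_cast; linear_combination (2 * j + 1 : ℝ) * hz]
    rw [sin_add_nat_mul_two_pi, sin_pi_sub]
  have h2 : ∀ j : ℕ, 2 * j + 1 + 1 = 2 * (j + 1) := fun j => by ring
  rw [Finset.sum_range_succ, sum_range_two_mul]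
  have h3 : ∀ j : ℕ, (-1 : ℝ) ^ (2 * j) = 1 := fun j => (even_two_mul j).neg_one_pow
  have h4 : ∀ j : ℕ, (-1 : ℝ) ^ (2 * j + 1) = -1 := fun j => (odd_two_mul_add_one j).neg_one_pow
  simp only [h2, h0, h1, h3, h4, archFreq_two_mul, archFreq_two_mul_add_one, sub_self, zero_mul, sin_zero]
  set S := ∑ j ∈ Finset.range (m + 1), sin (j * η) with hS
  have s1 : ∑ j ∈ Finset.range m, sin (j * η) = S - sin (m * η) := by
    rw [hS, Finset.sum_range_succ]; ring
  have s2 : ∑ j ∈ Finset.range m, sin ((j + 1 : ℕ) * η) = S := by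
    rw [hS, Finset.sum_range_succ']; simp
  have s3 : ∑ j ∈ Finset.range m, sin ((m - j) * η) = S := by
    have := Finset.sum_range_reflect (fun j : ℕ => sin (j * η)) (m + 1)
    rw [← hS, Finset.sum_range_succ] at this
    rw [← this]
    simp only [add_tsub_cancel_right, tsub_self, Nat.cast_zero, zero_mul, sin_zero, add_zero]
    refine Finset.sum_congr rfl fun j hj => ?_
    rw [Nat.cast_sub (Finset.mem_range.1 hj).le]
  have e : ∀ j : ℕ, 1 * (sin (j * η) + sin ((m - j) * η)) / c (√α)
      + -1 * (sin ((m - j) * η) + sin ((j + 1 : ℕ) * η)) / c (√β)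
      = (1 / c (√α)) * sin (j * η) + (1 / c (√α) - 1 / c (√β)) * sin ((m - j) * η)
        - (1 / c (√β)) * sin ((j + 1 : ℕ) * η) := fun j => by ring
  simp only [e]
  rw [Finset.sum_sub_distrib, Finset.sum_add_distrib, ← Finset.mul_sum, ← Finset.mul_sum,
    ← Finset.mul_sum, s1, s2, s3]
  ring

end arches

/-! ### Lower bounds for sine sums and the central inequality. -/

section bounds

/-- Summation of sin x ≥ x − x³/6, with Σ j = m(m+1)/2 and Σ j³ = (m(m+1))²/4. -/
theorem sum_sin_natCast_mul_ge {η : ℝ} (hη : 0 ≤ η) (m : ℕ) :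
    η * (m * (m + 1)) / 2 - η ^ 3 * (m * (m + 1)) ^ 2 / 24
      ≤ ∑ j ∈ Finset.range (m + 1), sin (j * η) := by
  induction m with
  | zero => simp
  | succ m ih =>
    rw [Finset.sum_range_succ]
    have := sin_ge_sub_cube (x := (m + 1 : ℕ) * η) (by positivity)
    push_cast at this ⊢
    linear_combination ih + this

/-- Needed separately, since the cubic lower bound may be negative. -/
theorem sum_sin_natCast_mul_nonneg {η : ℝ} (hη : 0 ≤ η) {m : ℕ} (h : m * η ≤ π) :
    0 ≤ ∑ j ∈ Finset.range (m + 1), sin (j * η) := by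
  refine Finset.sum_nonneg fun j hj => sin_nonneg_of_nonneg_of_le_pi (by positivity) ?_
  refine le_trans ?_ h
  gcongr
  exact Nat.lt_succ_iff.1 (Finset.mem_range.1 hj)

/-- The estimate behind the weights: `a` short arches of frequency `ω` and `b` long arches of
frequency `τ` fill `[0, π]`. -/
theorem distance_sq_le_of_arches {a b ω τ T c : ℝ} (ha : 0 < a) (hb : 0 < b) (hτ : 0 < τ)
    (hω : a + b < ω) (hsum : a * (π / ω) + b * (π / τ) = π) (hc : 0 ≤ c) (hT0 : 0 ≤ T)
    (hT : a * (π * (1 - (a + b) / ω)) * (1 - c * (π * (1 - (a + b) / ω)) ^ 2) ≤ T) :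
    a * ((τ / ω) ^ 2 * (π / ω) / 2) + b * ((τ / τ) ^ 2 * (π / τ) / 2) + π / 2
        - 2 * (τ * (T * (1 / (ω ^ 2 - (a + b) ^ 2) - 1 / (τ ^ 2 - (a + b) ^ 2))))
      ≤ π * ((a / b) ^ 2 / 2 + 3 * (a / b) / 2 + c * π ^ 2) * (ω / (a + b) - 1) ^ 2 := by
  have hπ := pi_pos
  obtain ⟨N, hN⟩ : ∃ N, N = a + b := ⟨_, rfl⟩
  obtain ⟨δ, hδ⟩ : ∃ δ, δ = 1 - N / ω := ⟨_, rfl⟩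
  have hN0 : 0 < N := by rw [hN]; positivity
  rw [← hN] at hω hT ⊢
  rw [← hδ] at hT
  have hω0 : 0 < ω := hN0.trans hω
  have hδ0 : 0 < δ := by rw [hδ, sub_pos, div_lt_one hω0]; exact hω
  have hδ1 : δ < 1 := by rw [hδ]; linarith [div_pos hN0 hω0]
  have h1δ : 0 < 1 - δ := by linarith
  have eω : ω = N / (1 - δ) := by
    rw [show 1 - δ = N / ω by linarith]; field_simp
  have hx : 0 < b + a * δ := by positivity
  have eτ : τ = N * b / (b + a * δ) := by
    have h1 : a * (1 / ω) + b * (1 / τ) = 1 := by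
      have : π * (a * (1 / ω) + b * (1 / τ)) = π * 1 := by linear_combination hsum
      exact mul_left_cancel₀ hπ.ne' this
    have h2 : 1 / ω = (1 - δ) / N := by rw [eω, one_div_div]
    rw [h2] at h1
    field_simp at h1 ⊢
    rw [hN] at h1 ⊢
    linear_combination -h1
  -- The left side is the leading term of the right side as δ → 0; the excess, computed in `e3`, is
  -- positive.
  have hB : 1 / (2 * a * N * δ) ≤ 1 / (ω ^ 2 - N ^ 2) - 1 / (τ ^ 2 - N ^ 2) := by
    have e1 : 1 / (ω ^ 2 - N ^ 2) = (1 - δ) ^ 2 / (N ^ 2 * (δ * (2 - δ))) := by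
      rw [eω]
      have : δ * (2 - δ) ≠ 0 := by nlinarith
      have h3 : (N / (1 - δ)) ^ 2 - N ^ 2 = N ^ 2 * (δ * (2 - δ)) / (1 - δ) ^ 2 := by
        field_simp; ring
      rw [h3, one_div_div]
    have e2 : 1 / (τ ^ 2 - N ^ 2)
        = -((b + a * δ) ^ 2 / (N ^ 2 * (a * δ * (2 * b + a * δ)))) := by
      rw [eτ]
      have h3 : (N * b / (b + a * δ)) ^ 2 - N ^ 2
          = -(N ^ 2 * (a * δ * (2 * b + a * δ)) / (b + a * δ) ^ 2) := by
        field_simp; ring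
      rw [h3, one_div, inv_neg, inv_div]
    have h2δ : 0 < 2 - δ := by linarith
    have e3 : (1 - δ) ^ 2 / (N ^ 2 * (δ * (2 - δ)))
        - -((b + a * δ) ^ 2 / (N ^ 2 * (a * δ * (2 * b + a * δ)))) - 1 / (2 * a * N * δ)
        = δ * N / (2 * N ^ 2 * (2 - δ) * (2 * b + a * δ)) := by
      field_simp
      rw [hN]; ring
    rw [e1, e2, ← sub_nonneg, e3]
    positivity
  have hTB : b / (b + a * δ) * (π * (1 - c * (π * δ) ^ 2))
      ≤ 2 * (τ * (T * (1 / (ω ^ 2 - N ^ 2) - 1 / (τ ^ 2 - N ^ 2)))) := by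
    calc b / (b + a * δ) * (π * (1 - c * (π * δ) ^ 2))
        = 2 * (τ * ((a * (π * δ) * (1 - c * (π * δ) ^ 2)) * (1 / (2 * a * N * δ)))) := by
          rw [eτ]; field_simp
      _ ≤ 2 * (τ * (T * (1 / (2 * a * N * δ)))) := by gcongr
      _ ≤ _ := by gcongr
  obtain ⟨κ, hκ⟩ : ∃ κ, κ = a / b := ⟨_, rfl⟩
  have hκ0 : 0 < κ := by rw [hκ]; positivity
  have ea : a = κ * b := by rw [hκ]; field_simp
  have hr : 0 < 1 + κ * δ := by positivity
  have eI : a * ((τ / ω) ^ 2 * (π / ω) / 2) + b * ((τ / τ) ^ 2 * (π / τ) / 2)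
      = π * (1 + 3 * κ * δ ^ 2 + κ * (κ - 1) * δ ^ 3) / (2 * (1 + κ * δ) ^ 2) := by
    rw [div_self hτ.ne', eτ, eω, hN, ea]
    have h5 : b + κ * b * δ = b * (1 + κ * δ) := by ring
    have h6 : κ * b + b = b * (1 + κ) := by ring
    rw [h5, h6]
    field_simp
    ring
  have eq : b / (b + a * δ) = 1 / (1 + κ * δ) := by rw [ea]; field_simp
  have eε : ω / N - 1 = δ / (1 - δ) := by rw [eω]; field_simp; ring
  rw [eI, eε, ← hκ]
  rw [eq] at hTB
  -- The inequality is proved in δ; the weights use the larger quantity ω/N − 1 = δ/(1 − δ).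
  have hε : δ ^ 2 ≤ (δ / (1 - δ)) ^ 2 := by
    gcongr
    rw [le_div_iff₀ h1δ]; nlinarith
  have hX : 0 ≤ π * (κ ^ 2 / 2 + 3 * κ / 2 + c * π ^ 2) := by positivity
  -- In the expansion of the left side at δ = 0 the orders 0 and 1 cancel, and the constant on the
  -- right is exactly the coefficient of δ². The remainder carries a factor δ³ and a fixed sign.
  have hmain : π * (1 + 3 * κ * δ ^ 2 + κ * (κ - 1) * δ ^ 3) / (2 * (1 + κ * δ) ^ 2) + π / 2
      - 1 / (1 + κ * δ) * (π * (1 - c * (π * δ) ^ 2))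
      ≤ π * (κ ^ 2 / 2 + 3 * κ / 2 + c * π ^ 2) * δ ^ 2 := by
    have e : π * (κ ^ 2 / 2 + 3 * κ / 2 + c * π ^ 2) * δ ^ 2
      - (π * (1 + 3 * κ * δ ^ 2 + κ * (κ - 1) * δ ^ 3) / (2 * (1 + κ * δ) ^ 2) + π / 2
      - 1 / (1 + κ * δ) * (π * (1 - c * (π * δ) ^ 2)))
      = π * δ ^ 3 * κ * ((κ ^ 2 / 2 + 3 * κ / 2 + c * π ^ 2) * (2 + κ * δ) - (κ - 1) / 2
          - c * π ^ 2) / (1 + κ * δ) ^ 2 := by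
      field_simp
      ring
    rw [← sub_nonneg, e]
    have : 0 ≤ (κ ^ 2 / 2 + 3 * κ / 2 + c * π ^ 2) * (2 + κ * δ) - (κ - 1) / 2
          - c * π ^ 2 := by
      rw [show (κ ^ 2 / 2 + 3 * κ / 2 + c * π ^ 2) * (2 + κ * δ) - (κ - 1) / 2 - c * π ^ 2
        = κ ^ 2 + 5 * κ / 2 + c * π ^ 2 + 1 / 2
          + (κ ^ 2 / 2 + 3 * κ / 2 + c * π ^ 2) * (κ * δ) by ring]
      positivity
    positivity
  calc _ ≤ π * (1 + 3 * κ * δ ^ 2 + κ * (κ - 1) * δ ^ 3) / (2 * (1 + κ * δ) ^ 2) + π / 2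
      - 1 / (1 + κ * δ) * (π * (1 - c * (π * δ) ^ 2)) := by linarith
    _ ≤ _ := hmain.trans (mul_le_mul_of_nonneg_left hε hX)

end bounds

/-! ### Distance from a Fučík eigenfunction to the matching sine. -/

section distance
variable {α β : ℝ} {u : ℝ → ℝ}

theorem fucikWeight_nonneg (n : ℕ) (x y : ℝ) : 0 ≤ fucikWeight n x y := by
  unfold fucikWeight
  have h4 : 0 ≤ ((n : ℝ) - 1) ^ 4 := (by decide : Even 4).pow_nonneg _
  have h2 : ∀ z : ℝ, 0 ≤ z ^ 2 := fun z => sq_nonneg z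
  split_ifs
  · exact mul_nonneg (by positivity) (h2 _)
  · exact mul_nonneg (mul_nonneg (by positivity) (div_nonneg (by positivity) h4)) (h2 _)
  · exact mul_nonneg (by positivity) (h2 _)

/-- The curve is the hyperbola aτ + bω = ωτ. For a > 0 this form shows that the two frequencies lie
on opposite sides of a + b, or both equal it. -/
theorem arch_frequencies_relation {a b ω τ : ℝ} (hω : 0 < ω) (hτ : 0 < τ) (hb : 0 < b)
    (hsum : a * (π / ω) + b * (π / τ) = π) :
    0 < ω - a ∧ (ω - a) * (τ - (a + b)) = -a * (ω - (a + b)) := by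
  have h : a * τ + b * ω = ω * τ := by
    have : π * (a * τ + b * ω) = π * (ω * τ) := by
      field_simp at hsum
      linear_combination π * hsum
    exact mul_left_cancel₀ pi_pos.ne' this
  constructor
  · by_contra hneg
    nlinarith [mul_pos hb hω]
  · linear_combination (-1) * h

theorem eqOn_sin_of_archFreq_eq (h : IsFucikSolution α β u) (hα : 0 < α) (hβ : 0 < β) {n : ℕ}
    (hn : 0 < n) (h1 : derivWithin u (Icc 0 π) 0 = n) (hA : √α = n) (hB : √β = n) {x : ℝ}
    (hx : x ∈ Icc 0 π) : u x = sin (n * x) := by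
  have hn' : (0 : ℝ) < n := by exact_mod_cast hn
  have hw : ∀ i, archFreq α β i = n := fun i => by unfold archFreq; split_ifs <;> assumption
  have hz : ∀ i, archZero α β i = i * (π / n) := fun i => by
    simp [archZero, hw]
  have hz' : archZero α β n = π := by rw [hz]; field_simp
  obtain ⟨i, hi, hxi⟩ := exists_mem_arch (α := α) (β := β) n hx.1 (hz'.symm ▸ hx.2) hn
  rw [h.eq_on_arch hα hβ hn' h1 i (hz' ▸ archZero_mono hα hβ hi) hxi, hw, hz, div_self hn'.ne',
    one_mul, show (n : ℝ) * (x - i * (π / n)) = n * x - i * π by field_simp,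
    sin_sub_nat_mul_pi, ← mul_assoc, ← mul_pow]
  simp

theorem integral_sub_sin_sq (hu : ContinuousOn u (Icc 0 π)) {n : ℕ} (hn : 0 < n) :
    ∫ x in 0..π, (u x - sin (n * x)) ^ 2
      = (∫ x in 0..π, u x ^ 2) + π / 2 - 2 * ∫ x in 0..π, u x * sin (n * x) := by
  rw [← uIcc_of_le pi_pos.le] at hu
  have hs : ∫ x in 0..π, sin (n * x) * sin (n * x) = π / 2 := by
    obtain ⟨k, rfl⟩ : ∃ k, n = k + 1 := ⟨n - 1, by omega⟩
    rw [integral_sin_nat_mul_sin_nat, if_pos rfl]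
  have e : ∀ x, (u x - sin (n * x)) ^ 2
      = u x ^ 2 + sin (n * x) * sin (n * x) - 2 * (u x * sin (n * x)) := fun x => by ring
  simp_rw [e]
  rw [intervalIntegral.integral_sub, intervalIntegral.integral_add,
    intervalIntegral.integral_const_mul, hs]
  all_goals exact ContinuousOn.intervalIntegrable (by fun_prop)

/-- Distance of a Fučík eigenfunction with `a` positive and `b` negative arches to the
corresponding sine function, given the sums over its arches. -/
theorem IsNormalizedFucikEigenfunction.integral_sub_sin_sq_le
    (h : IsNormalizedFucikEigenfunction α β u) (hα : 0 < α) (hβ : 0 < β) {n : ℕ} (hn : 2 ≤ n)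
    (hz : archZero α β n = π) {a b T c W : ℝ} (ha : 0 < a) (hb : 0 < b) (hab : (n : ℝ) = a + b)
    (hc : 0 ≤ c) (hW : 0 ≤ W)
    (hsum : a * (π / √α) + b * (π / √β) = π)
    (hfreq : ∀ g : ℝ → ℝ, ∑ i ∈ Finset.range n, g (archFreq α β i) = a * g (√α) + b * g (√β))
    (hsin : ∀ g : ℝ → ℝ, ∑ i ∈ Finset.range n, (-1) ^ i * (sin (n * archZero α β i)
        + sin (n * archZero α β (i + 1))) / g (archFreq α β i) = T * (1 / g (√α) - 1 / g (√β)))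
    (hTα : a + b < √α → 0 ≤ T ∧ a * (π * (1 - (a + b) / √α))
      * (1 - a / b * c * (π * (1 - (a + b) / √α)) ^ 2) ≤ T)
    (hTβ : a + b < √β → 0 ≤ -T ∧ b * (π * (1 - (a + b) / √β))
      * (1 - b / a * c * (π * (1 - (a + b) / √β)) ^ 2) ≤ -T)
    (hWα : a + b < √α → π * ((a / b) ^ 2 / 2 + 3 * (a / b) / 2 + a / b * c * π ^ 2)
      * (√α / (a + b) - 1) ^ 2 ≤ W)
    (hWβ : a + b < √β → π * ((b / a) ^ 2 / 2 + 3 * (b / a) / 2 + b / a * c * π ^ 2)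
      * (√β / (a + b) - 1) ^ 2 ≤ W) :
    ∫ x in 0..π, (u x - sin (n * x)) ^ 2 ≤ W := by
  have hA := Real.sqrt_pos.2 hα
  have hB := Real.sqrt_pos.2 hβ
  have hp := h.derivWithin_zero hα hβ hn hz
  have hp0 : 0 < min (√α) (√β) := lt_min hA hB
  obtain ⟨hr1, hr2⟩ := arch_frequencies_relation hA hB hb hsum
  -- In this degenerate case both frequencies equal n and u is sin(nx) itself; the formula for the
  -- cross term would divide by zero.
  by_cases hAN : √α = a + b
  · have hBN : √β = a + b := by
      rw [hAN, sub_self, mul_zero, ← hAN] at hr2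
      rcases mul_eq_zero.1 hr2 with h0 | h0 <;> linarith
    rw [hAN, hBN, min_self, ← hab] at hp
    rw [intervalIntegral.integral_congr (g := fun _ => (0 : ℝ))]
    · simpa using hW
    · intro x hx
      rw [uIcc_of_le pi_pos.le] at hx
      simp only
      rw [eqOn_sin_of_archFreq_eq h.solution hα hβ (by omega) hp (hAN.trans hab.symm)
        (hBN.trans hab.symm) hx]
      simp
  · have hBN : √β ≠ a + b := by
      intro h0
      rw [h0, sub_self, mul_zero] at hr2
      rcases mul_eq_zero.1 hr2.symm with h0 | h0
      · linarith
      · exact hAN (by linarith)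
    have hN0 : 0 < a + b := by positivity
    have hne : ∀ i, archFreq α β i ^ 2 ≠ (n : ℝ) ^ 2 := by
      intro i hi
      have := (pow_left_inj₀ (archFreq_pos hα hβ i).le (by positivity) two_ne_zero).1 hi
      rw [hab] at this
      unfold archFreq at this
      split_ifs at this
      · exact hAN this
      · exact hBN this
    rw [integral_sub_sin_sq h.solution.contDiffOn.continuousOn (by omega),
      h.solution.integral_sq hα hβ hp0 hp hz, h.solution.integral_mul_sin hα hβ hp0 hp hz hne,
      hfreq (fun w => (min (√α) (√β) / w) ^ 2 * (π / w) / 2), hsin (fun w => w ^ 2 - (n : ℝ) ^ 2),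
      hab]
    rcases lt_or_gt_of_ne hAN with hlt | hlt
    -- Here the negative arches are the short ones: a and b exchange roles, and T changes sign
    -- because the difference of reciprocals does.
    · have hlt' : a + b < √β := by
        have : 0 < (√α - a) * (√β - (a + b)) := by rw [hr2]; nlinarith
        linarith [pos_of_mul_pos_right this hr1.le]
      have hsum' : b * (π / √β) + a * (π / √α) = π := by linarith
      obtain ⟨hT1, hT2⟩ := hTβ hlt'
      have key := distance_sq_le_of_arches hb ha hA (by linarith) hsum'
        (c := b / a * c) (T := -T) (by positivity) hT1 (by rwa [add_comm b a])
      rw [add_comm b a] at key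
      have hW' := hWβ hlt'
      rw [min_eq_left (hlt.trans hlt').le]
      linarith
    · have hlt' : √β < a + b := by
        have : 0 < (√α - a) * ((a + b) - √β) := by nlinarith
        linarith [pos_of_mul_pos_right this hr1.le]
      obtain ⟨hT1, hT2⟩ := hTα hlt
      have key := distance_sq_le_of_arches ha hb hB hlt hsum
        (c := a / b * c) (T := T) (by positivity) hT1 hT2
      have hW' := hWα hlt
      rw [min_eq_right (hlt'.trans hlt).le]
      linarith

theorem pi_sq_lt_ten : π ^ 2 < 10 := by
  have h1 := pi_lt_d2
  have h2 := pi_pos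
  nlinarith

/-- The cubic bound for sine; the factor `m / m` is the ratio a/b of the general estimate, with a =
b = m. -/
theorem nat_mul_sin_arch_bounds {m : ℕ} {δ : ℝ} (h0 : 0 ≤ δ) (h1 : δ ≤ 1) :
    0 ≤ m * sin (π * δ) ∧ m * (π * δ) * (1 - m / m * (1 / 6) * (π * δ) ^ 2) ≤ m * sin (π * δ) := by
  have hπ := pi_pos
  rcases Nat.eq_zero_or_pos m with rfl | hm
  · simp
  have hm' : (m : ℝ) ≠ 0 := by positivity
  refine ⟨mul_nonneg (by positivity) (sin_nonneg_of_nonneg_of_le_pi (by positivity)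
    (by nlinarith)), ?_⟩
  rw [div_self hm', mul_assoc]
  gcongr
  refine le_trans (le_of_eq ?_) (sin_ge_sub_cube (by positivity : 0 ≤ π * δ))
  ring

theorem integral_sub_sin_sq_le_fucikWeight_even
    (h : IsNormalizedFucikEigenfunction α β u) {m : ℕ} (hm : 1 ≤ m)
    (hmem : (α, β) ∈ fucikCurve (2 * m)) :
    ∫ x in 0..π, (u x - sin ((2 * m : ℕ) * x)) ^ 2 ≤ fucikWeight (2 * m) α β := by
  have hπ := pi_pos
  obtain ⟨hα, hβ, hcurve⟩ := hmem
  simp only at hα hβ hcurve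
  have hm' : (0 : ℝ) < m := by exact_mod_cast hm
  have hcast : ((2 * m : ℕ) : ℝ) = m + m := by push_cast; ring
  have hA := Real.sqrt_pos.2 hα
  have hB := Real.sqrt_pos.2 hβ
  rw [if_pos (even_two_mul m), hcast] at hcurve
  have hsum : (m : ℝ) * (π / √α) + m * (π / √β) = π := by linarith
  have hsum' : (m : ℝ) * (π / √α + π / √β) = π := by linarith
  have hW : ∀ z ≤ max (√α) (√β), (m : ℝ) + m < z →
      π * (((m : ℝ) / m) ^ 2 / 2 + 3 * ((m : ℝ) / m) / 2 + (m : ℝ) / m * (1 / 6) * π ^ 2)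
      * (z / (m + m) - 1) ^ 2 ≤ fucikWeight (2 * m) α β := by
    intro z hz hz'
    rw [fucikWeight, if_pos (even_two_mul m), div_self hm'.ne', hcast]
    have h1 : 0 ≤ z / (m + m) - 1 := by
      rw [sub_nonneg, one_le_div₀ (by positivity)]; exact hz'.le
    have h2 : (z / (m + m) - 1) ^ 2 ≤ (max (√α) (√β) / (m + m) - 1) ^ 2 := by gcongr
    -- For a = b the estimate has the constant 2 + π²/6, which is below 4(3 + π²)/9 because π² ≥
    -- 12/5.
    calc _ ≤ 4 * (3 + π ^ 2) * π / 9 * (z / (m + m) - 1) ^ 2 := by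
          gcongr
          nlinarith [pi_gt_three]
      _ ≤ _ := by gcongr
  refine h.integral_sub_sin_sq_le hα hβ (by omega) (by rw [archZero_two_mul, hsum']) hm' hm' hcast
    (c := 1 / 6) (T := m * sin ((2 * m : ℕ) * (π / √α)))
    (by norm_num) (fucikWeight_nonneg _ _ _) hsum (fun g => sum_comp_archFreq_even g m)
    (fun g => sum_sin_archZero_even hsum' g) ?_ ?_ (hW _ (le_max_left _ _))
    (hW _ (le_max_right _ _))
  · intro hlt
    have e : sin ((2 * m : ℕ) * (π / √α)) = sin (π * (1 - (m + m) / √α)) := by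
      rw [← sin_pi_sub, hcast]; congr 1; ring
    rw [e]
    refine nat_mul_sin_arch_bounds ?_ ?_
    · rw [sub_nonneg, div_le_one hA]; exact hlt.le
    · linarith [div_pos (add_pos hm' hm') hA]
  · intro hlt
    have e : -(m * sin ((2 * m : ℕ) * (π / √α))) = m * sin (π * (1 - (m + m) / √β)) := by
      rw [show (2 * m : ℕ) * (π / √α) = π * (1 - (m + m) / √β) + π by
        rw [hcast]; linear_combination 2 * hsum, sin_add_pi]
      ring
    rw [e]
    refine nat_mul_sin_arch_bounds ?_ ?_
    · rw [sub_nonneg, div_le_one hB]; exact hlt.le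
    · linarith [div_pos (add_pos hm' hm') hB]

theorem integral_sub_sin_sq_le_fucikWeight_odd
    (h : IsNormalizedFucikEigenfunction α β u) {m : ℕ} (hm : 1 ≤ m)
    (hmem : (α, β) ∈ fucikCurve (2 * m + 1)) :
    ∫ x in 0..π, (u x - sin ((2 * m + 1 : ℕ) * x)) ^ 2 ≤ fucikWeight (2 * m + 1) α β := by
  have hπ := pi_pos
  have hπ2 := pi_sq_lt_ten
  have hodd : ¬ Even (2 * m + 1) := Nat.not_even_iff_odd.2 (odd_two_mul_add_one m)
  obtain ⟨hα, hβ, hcurve⟩ := hmem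
  simp only at hα hβ hcurve
  have hm' : (0 : ℝ) < m := by exact_mod_cast hm
  have hm1 : (0 : ℝ) < m + 1 := by positivity
  have hcast : ((2 * m + 1 : ℕ) : ℝ) = (m + 1) + m := by push_cast; ring
  have hA := Real.sqrt_pos.2 hα
  have hB := Real.sqrt_pos.2 hβ
  rw [if_neg hodd, hcast] at hcurve
  have hsum : ((m : ℝ) + 1) * (π / √α) + m * (π / √β) = π := by linarith
  obtain ⟨hr1, hr2⟩ := arch_frequencies_relation hA hB hm' hsum
  set S := ∑ j ∈ Finset.range (m + 1), sin (j * (π / √β - π / √α)) with hS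
  refine h.integral_sub_sin_sq_le hα hβ (by omega)
    (by rw [archZero_two_mul_add_one]; linarith) hm1 hm' hcast
    -- The constant 1/12 is twice the 1/24 of the summed cubic bound. The ratio a/b beside it
    -- appears on substituting η = πδ/m or πδ/(m + 1).
    (c := 1 / 12) (T := 2 * S)
    (by norm_num) (fucikWeight_nonneg _ _ _) hsum (fun g => sum_comp_archFreq_odd g m)
    (fun g => sum_sin_archZero_odd hsum g) ?_ ?_ ?_ ?_
  · intro hlt
    set δ := 1 - ((m : ℝ) + 1 + m) / √α with hδ
    have hδ0 : 0 ≤ δ := by rw [hδ, sub_nonneg, div_le_one hA]; exact hlt.le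
    have hδ1 : δ ≤ 1 := by rw [hδ]; linarith [div_pos (add_pos hm1 hm') hA]
    have e : π / √β - π / √α = π * δ / m := by
      rw [eq_div_iff hm'.ne', hδ]; linear_combination hsum
    have h1 := sum_sin_natCast_mul_ge (η := π * δ / m) (by positivity) m
    have h2 := sum_sin_natCast_mul_nonneg (η := π * δ / m) (by positivity) (m := m)
      (by rw [mul_div_cancel₀ _ hm'.ne']; nlinarith)
    rw [hS, e]
    refine ⟨by linarith, le_trans (le_of_eq ?_) (mul_le_mul_of_nonneg_left h1 zero_le_two)⟩
    field_simp
    ring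
  · intro hlt
    set δ := 1 - ((m : ℝ) + 1 + m) / √β with hδ
    have hδ0 : 0 ≤ δ := by rw [hδ, sub_nonneg, div_le_one hB]; exact hlt.le
    have hδ1 : δ ≤ 1 := by rw [hδ]; linarith [div_pos (add_pos hm1 hm') hB]
    have e : π / √β - π / √α = -(π * δ / (m + 1)) := by
      rw [← neg_sub, neg_inj, eq_div_iff hm1.ne', hδ]; linear_combination hsum
    have h1 := sum_sin_natCast_mul_ge (η := π * δ / (m + 1)) (by positivity) m
    have h2 := sum_sin_natCast_mul_nonneg (η := π * δ / (m + 1)) (by positivity) (m := m)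
      (by rw [← mul_div_assoc, div_le_iff₀ hm1]; nlinarith [mul_nonneg hm'.le hπ.le])
    have e2 : -(2 * S) = 2 * ∑ j ∈ Finset.range (m + 1), sin (j * (π * δ / (m + 1))) := by
      rw [hS, e]
      simp only [mul_neg, sin_neg, Finset.sum_neg_distrib, neg_neg]
    rw [e2]
    refine ⟨by linarith, le_trans (le_of_eq ?_) (mul_le_mul_of_nonneg_left h1 zero_le_two)⟩
    field_simp
    ring
  · intro hlt
    -- Otherwise both frequencies would exceed n, against `hr2`.
    have hlt' : √β ≤ √α := by
      by_contra hcon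
      have : (√α - (m + 1)) * (√β - (m + 1 + m)) > 0 := mul_pos hr1 (by linarith)
      nlinarith
    rw [fucikWeight, if_neg hodd, if_pos ((Real.sqrt_le_sqrt_iff hα.le).1 hlt'), hcast]
    refine mul_le_mul_of_nonneg_right ?_ (sq_nonneg _)
    rw [show (m : ℝ) + 1 + m - 1 = 2 * m by ring, show 4 * π * (((m : ℝ) + 1 + m) ^ 2
      * ((m + 1 + m) ^ 2 + 1) / (2 * m) ^ 4) = π * (4 * ((m + 1 + m) ^ 2
      * ((m + 1 + m) ^ 2 + 1) / (2 * m) ^ 4)) by ring]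
    refine mul_le_mul_of_nonneg_left ?_ hπ.le
    -- Replacing π² by 10 makes the comparison rational in m; the difference then has a numerator
    -- with positive coefficients only.
    calc (((m : ℝ) + 1) / m) ^ 2 / 2 + 3 * ((m + 1) / m) / 2 + (m + 1) / m * (1 / 12) * π ^ 2
        ≤ (((m : ℝ) + 1) / m) ^ 2 / 2 + 3 * ((m + 1) / m) / 2 + (m + 1) / m * (1 / 12) * 10 := by
          gcongr
      _ ≤ _ := by
          rw [← sub_nonneg]
          have e : 4 * (((m : ℝ) + 1 + m) ^ 2 * ((m + 1 + m) ^ 2 + 1) / (2 * m) ^ 4)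
            - ((((m : ℝ) + 1) / m) ^ 2 / 2 + 3 * ((m + 1) / m) / 2 + (m + 1) / m * (1 / 12) * 10)
            = (7 * m ^ 4 + 28 * m ^ 3 + 39 * m ^ 2 + 18 * m + 3) / (6 * m ^ 4) := by
            field_simp
            ring
          rw [e]; positivity
  · intro hlt
    have hlt' : ¬ β ≤ α := by
      intro hcon
      have h1 := Real.sqrt_le_sqrt hcon
      have : (√α - (m + 1)) * (√β - (m + 1 + m)) > 0 := mul_pos hr1 (by linarith)
      nlinarith
    rw [fucikWeight, if_neg hodd, if_neg hlt', hcast]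
    refine mul_le_mul_of_nonneg_right ?_ (sq_nonneg _)
    rw [show (m : ℝ) + 1 + m + 1 = 2 * (m + 1) by ring, show 5 * π * (((m : ℝ) + 1 + m) ^ 2
      * ((m + 1 + m) ^ 2 + 1) / (2 * (m + 1)) ^ 4) = π * (5 * ((m + 1 + m) ^ 2
      * ((m + 1 + m) ^ 2 + 1) / (2 * (m + 1)) ^ 4)) by ring]
    refine mul_le_mul_of_nonneg_left ?_ hπ.le
    calc ((m : ℝ) / (m + 1)) ^ 2 / 2 + 3 * (m / (m + 1)) / 2 + m / (m + 1) * (1 / 12) * π ^ 2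
        ≤ ((m : ℝ) / (m + 1)) ^ 2 / 2 + 3 * (m / (m + 1)) / 2 + m / (m + 1) * (1 / 12) * 10 := by
          gcongr
      _ ≤ _ := by
          rw [← sub_nonneg]
          have e : 5 * (((m : ℝ) + 1 + m) ^ 2 * ((m + 1 + m) ^ 2 + 1) / (2 * (m + 1)) ^ 4)
            - (((m : ℝ) / (m + 1)) ^ 2 / 2 + 3 * (m / (m + 1)) / 2 + m / (m + 1) * (1 / 12) * 10)
            = (52 * m ^ 4 + 48 * m ^ 3 + 30 * m ^ 2 + 34 * m + 15) / (24 * (m + 1) ^ 4) := by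
            field_simp
            ring
          rw [e]; positivity

theorem integral_sub_sin_sq_le_fucikWeight (h : IsNormalizedFucikEigenfunction α β u) {n : ℕ}
    (hn : 2 ≤ n) (hmem : (α, β) ∈ fucikCurve n) :
    ∫ x in 0..π, (u x - sin (n * x)) ^ 2 ≤ fucikWeight n α β := by
  rcases n.even_or_odd' with ⟨m, rfl | rfl⟩
  · exact integral_sub_sin_sq_le_fucikWeight_even h (by omega) hmem
  · exact integral_sub_sin_sq_le_fucikWeight_odd h (by omega) hmem

theorem IsFucikSystem.continuousOn {α β : ℕ → ℝ} {f : ℕ → ℝ → ℝ} (hf : IsFucikSystem α β f)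
    (k : ℕ) : ContinuousOn (f (k + 1)) (Icc 0 π) := by
  rcases k with _ | k
  · exact continuous_sin.continuousOn.congr hf.first
  · exact (hf.eigenfunction (k + 2) (by omega)).solution.contDiffOn.continuousOn

theorem IsFucikSystem.integral_first_sub_sin_sq {α β : ℕ → ℝ} {f : ℕ → ℝ → ℝ}
    (hf : IsFucikSystem α β f) :
    ∫ x in 0..π, (f (0 + 1) x - sin ((0 + 1 : ℕ) * x)) ^ 2 = 0 := by
  rw [intervalIntegral.integral_congr (g := fun _ => (0 : ℝ))]
  · simp
  · intro x hx
    rw [uIcc_of_le pi_pos.le] at hx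
    simp only
    rw [hf.first hx]
    simp

end distance

/-! ### The Riesz basis theorem. -/

theorem theorem1 {𝕜 : Type*} [RCLike 𝕜] (α β : ℕ → ℝ) (f : ℕ → ℝ → ℝ)
    (hf : IsFucikSystem α β f)
    (hsummable : Summable fun k : ℕ => fucikWeight (k + 2) (α (k + 2)) (β (k + 2)))
    (hsum : ∑' k : ℕ, fucikWeight (k + 2) (α (k + 2)) (β (k + 2)) < π / 2) :
    ∃ hL2 : ∀ k : ℕ, MemLp (fun x => (f (k + 1) x : 𝕜)) 2 (volume.restrict (Ioo 0 π)),
      IsRieszBasis 𝕜 (fun k : ℕ => (hL2 k).toLp) := by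
  refine ⟨fun k => memLp_ofReal_of_continuousOn (hf.continuousOn k), ?_⟩
  set ψ : ℕ → Lp 𝕜 2 (volume.restrict (Ioo 0 π)) :=
    fun k => (memLp_ofReal_of_continuousOn (𝕜 := 𝕜) (hf.continuousOn k)).toLp with hψ
  have hd : ∀ k, ‖ψ k - sineLp 𝕜 k‖ ^ 2
      = ∫ x in 0..π, (f (k + 1) x - sin ((k + 1 : ℕ) * x)) ^ 2 := fun k =>
    norm_toLp_ofReal_sub_sq (hf.continuousOn k) (continuousOn_sin_natCast_mul (k + 1))
  have h0 : ‖ψ 0 - sineLp 𝕜 0‖ ^ 2 = 0 := by rw [hd, hf.integral_first_sub_sin_sq]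
  have hle : ∀ k, ‖ψ (k + 1) - sineLp 𝕜 (k + 1)‖ ^ 2
      ≤ fucikWeight (k + 2) (α (k + 2)) (β (k + 2)) := fun k => by
    rw [hd]
    exact integral_sub_sin_sq_le_fucikWeight (hf.eigenfunction (k + 2) (by omega)) (by omega)
      (hf.mem_curve (k + 2) (by omega))
  have hs' : Summable fun k => ‖ψ (k + 1) - sineLp 𝕜 (k + 1)‖ ^ 2 :=
    Summable.of_nonneg_of_le (fun _ => sq_nonneg _) hle hsummable
  have hs : Summable fun k => ‖ψ k - sineLp 𝕜 k‖ ^ 2 := (summable_nat_add_iff 1).1 hs'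
  refine isRieszBasis_of_tsum_norm_sub_sq_lt inner_sineLp eq_zero_of_inner_sineLp_eq_zero hs ?_
  -- Index k stands for the eigenfunction k + 1; the term k = 0 is zero, so the weights are needed
  -- only from n = 2 on.
  rw [hs.tsum_eq_zero_add, h0, zero_add]
  exact (hs'.tsum_le_tsum hle hsummable).trans_lt hsum
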